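/- Let $\mathcal P\subset\mathbb R^N$ be compact with Lebesgue measure $\mu(\mathcal P)$, let $A,B,E,C,D,F$ be continuous (e.g. polynomial) matrix-valued functions on $\mathcal P$ with values in $\mathbb R^{n\times n},\mathbb R^{n\times m},\mathbb R^{n\times p},\mathbb R^{q\times n},\mathbb R^{q\times m},\mathbb R^{q\times p}$, and let $\lambda:\mathcal P\times\mathcal P\to[0,\infty)$ be continuous (e.g. polynomial), with $\bar\lambda(\rho)=\int_{\mathcal P}\lambda(\rho,\theta)\,d\theta$. Consider the system $$\dot x=A(\rho)x+B(\rho)u+E(\rho)w,\qquad z=C(\rho)x+D(\rho)u+F(\rho)w,\qquad x(0)=x_0,$$ where $(\rho(t))_{t\ge0}$ is a right-continuous, piecewise constant, $\mathcal P$-valued process with finitely many jumps in every bounded time interval, which is time-homogeneous Markov with respect to a filtration $(\mathcal F_t)$, starts at a point $\rho_0$, and satisfies $\mathbb P[\rho(t+h)\in \Lambda\mid\rho(t)=\rho]=h\int_\Lambda\lambda(\rho,\theta)\,d\theta+o(h)$ as $h\downarrow0$ for every $\rho\in\mathcal P$ and every measurable $\Lambda\subseteq\mathcal P\setminus\{\rho\}$.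 The state $x$ is $(\mathcal F_t)$-adapted with almost surely continuous paths, and disturbances $w$ are $(\mathcal F_t)$-progressively measurable, with $\|w\|_{L_2}=\big(\int_0^\infty\mathbb E\|w(s)\|_2^2\,ds\big)^{1/2}$. Theorem. Let $\gamma>0$. Suppose there are continuous functions $Q:\mathcal P\to\mathbb R^{n\times n}$, with $Q(\rho)$ symmetric positive definite for every $\rho$, and $U:\mathcal P\to\mathbb R^{m\times n}$, and a function $Z$ from $\mathcal P\times\mathcal P$ to the symmetric $n\times n$ matrices such that, for every $\rho\in\mathcal P$, $Z(\rho,\cdot)$ is integrable and $\int_{\mathcal P}Z(\rho,\theta)\,d\theta=0$. Suppose that for all $\rho,\theta\in\mathcal P$ $$\begin{bmatrix}\mathrm{He}[A(\rho)Q(\rho)+B(\rho)U(\rho)]-\bar\lambda(\rho)Q(\rho)+Z(\rho,\theta)&E(\rho)&(C(\rho)Q(\rho)+D(\rho)U(\rho))^T&\mu(\mathcal P)\lambda(\rho,\theta)^{1/2}Q(\rho)\\ \star&-\gamma^2I_p&F(\rho)^T&0\\ \star&\star&-I_q&0\\ \star&\star&\star&-\mu(\mathcal P)Q(\theta)\end{bmatrix}\prec0,$$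 where $\mathrm{He}[M]=M+M^T$ and $\star$ denotes the blocks determined by symmetry. Then the closed loop of the system with $u=K(\rho)x$, $K(\rho)=U(\rho)Q(\rho)^{-1}$, is mean-square stable for $w=0$, i.e. $\mathbb E\|x(t)\|_2^2\to0$ as $t\to\infty$ for all initial conditions $(x_0,\rho_0)$, and the $L_2$-gain $\sup_{\|w\|_{L_2}=1}\|z\|_{L_2}$ of the closed-loop map $w\mapsto z$ with $x_0=0$ (the supremum is also taken over $\rho_0$) is at most $\gamma$. -/

import Mathlib

open MeasureTheory ProbabilityTheory Filter Topology Asymptotics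
open scoped NNReal ENNReal Matrix

universe u

noncomputable section

/-- An LPV system `x' = A(ρ)x + B(ρ)u + E(ρ)w`, `z = C(ρ)x + D(ρ)u + F(ρ)w` whose parameter takes
values in a compact set `𝒫 ⊆ ℝᴺ` and jumps with instantaneous rate `κ(ρ, dθ) = rate ρ θ dθ`. -/
structure LPVSystem (N n m p q : ℕ) where
  /-- the set of parameter values -/
  param : Set (EuclideanSpace ℝ (Fin N))
  A : param → Matrix (Fin n) (Fin n) ℝ
  B : param → Matrix (Fin n) (Fin m) ℝ
  E : param → Matrix (Fin n) (Fin p) ℝ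
  C : param → Matrix (Fin q) (Fin n) ℝ
  D : param → Matrix (Fin q) (Fin m) ℝ
  F : param → Matrix (Fin q) (Fin p) ℝ
  /-- the density of the instantaneous jump rate -/
  rate : param → param → ℝ
  isCompact : IsCompact param
  continuous_A : Continuous A
  continuous_B : Continuous B
  continuous_E : Continuous E
  continuous_C : Continuous C
  continuous_D : Continuous D
  continuous_F : Continuous F
  continuous_rate : Continuous fun r : param × param => rate r.1 r.2
  rate_nonneg : ∀ ρ θ, 0 ≤ rate ρ θ

namespace LPVSystem

variable {N n m p q : ℕ} (S : LPVSystem N n m p q)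

/-- Lebesgue measure on `𝒫`. -/
def lebesgue : Measure S.param := Measure.comap Subtype.val volume

/-- The jump intensity `∫_𝒫 rate ρ θ dθ`. -/
def intensity (ρ : S.param) : ℝ := ∫ θ, S.rate ρ θ ∂S.lebesgue

/-- Transition functions of the parameter: a semigroup of Markov kernels `P h` on `𝒫` with
`P h (ρ, Λ) = κ(ρ, Λ) h + o(h)` as `h → 0⁺` for every measurable `Λ ⊆ 𝒫 \ {ρ}`. -/
structure IsTransitionFunction (P : ℝ≥0 → Kernel S.param S.param) : Prop where
  markov : ∀ h, IsMarkovKernel (P h)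
  zero : P 0 = Kernel.id
  chapman_kolmogorov : ∀ s h, P (s + h) = P h ∘ₖ P s
  infinitesimal : ∀ (ρ : S.param) (Λ : Set S.param), MeasurableSet Λ → ρ ∉ Λ →
    (fun h : ℝ≥0 => (P h ρ).real Λ - (∫ θ in Λ, S.rate ρ θ ∂S.lebesgue) * (h : ℝ))
      =o[𝓝[>] 0] fun h : ℝ≥0 => (h : ℝ)

section Stochastic

variable {Ω : Type u} {mΩ : MeasurableSpace Ω}

/-- The parameter process started at `ρ₀`: adapted to `ℱ`, piecewise constant and right-continuous
with finitely many jumps in every bounded interval, and Markov with respect to `ℱ` with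
instantaneous jump rate `rate ρ θ dθ`. -/
structure IsParameterEvolution (μ : Measure Ω) (ℱ : Filtration ℝ≥0 mΩ) (ρ₀ : S.param)
    (ρ : ℝ≥0 → Ω → S.param) : Prop where
  adapted : ∀ t, Measurable[ℱ t] (ρ t)
  initial : ∀ᵐ ω ∂μ, ρ 0 ω = ρ₀
  constant_right : ∀ ω t, ∀ᶠ s in 𝓝[>] t, ρ s ω = ρ t ω
  constant_left : ∀ ω t, ∃ c, ∀ᶠ s in 𝓝[<] t, ρ s ω = c
  markov : ∃ P : ℝ≥0 → Kernel S.param S.param, S.IsTransitionFunction P ∧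
    ∀ (s h : ℝ≥0) (Λ : Set S.param), MeasurableSet Λ →
      μ[(ρ (s + h) ⁻¹' Λ).indicator (fun _ => (1 : ℝ)) | ℱ s]
        =ᵐ[μ] fun ω => (P h (ρ s ω)).real Λ

/-- The right-hand side `A(ρ)x + B(ρ)u + E(ρ)w` of the state equation. -/
def drift (ρ : S.param) (x : EuclideanSpace ℝ (Fin n)) (v : EuclideanSpace ℝ (Fin m))
    (w : EuclideanSpace ℝ (Fin p)) : EuclideanSpace ℝ (Fin n) :=
  (S.A ρ).toEuclideanLin x + (S.B ρ).toEuclideanLin v + (S.E ρ).toEuclideanLin w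

/-- The controlled output `C(ρ)x + D(ρ)u + F(ρ)w`. -/
def output (ρ : S.param) (x : EuclideanSpace ℝ (Fin n)) (v : EuclideanSpace ℝ (Fin m))
    (w : EuclideanSpace ℝ (Fin p)) : EuclideanSpace ℝ (Fin q) :=
  (S.C ρ).toEuclideanLin x + (S.D ρ).toEuclideanLin v + (S.F ρ).toEuclideanLin w

/-- `x` is the state of the system with input `v`, disturbance `w` and `x(0) = x₀`: an adapted
process with almost surely continuous paths that solve the state equation in integral form. -/
structure IsState (μ : Measure Ω) (ℱ : Filtration ℝ≥0 mΩ) (ρ : ℝ≥0 → Ω → S.param)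
    (x₀ : EuclideanSpace ℝ (Fin n)) (v : ℝ≥0 → Ω → EuclideanSpace ℝ (Fin m))
    (w : ℝ≥0 → Ω → EuclideanSpace ℝ (Fin p)) (x : ℝ≥0 → Ω → EuclideanSpace ℝ (Fin n)) :
    Prop where
  adapted : ∀ t, Measurable[ℱ t] (x t)
  continuous : ∀ᵐ ω ∂μ, Continuous fun t => x t ω
  integral_eq : ∀ᵐ ω ∂μ, ∀ t : ℝ≥0,
    IntervalIntegrable (fun s : ℝ => S.drift (ρ s.toNNReal ω) (x s.toNNReal ω)
      (v s.toNNReal ω) (w s.toNNReal ω)) volume 0 t ∧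
    x t ω = x₀ + ∫ s in (0 : ℝ)..t, S.drift (ρ s.toNNReal ω) (x s.toNNReal ω)
      (v s.toNNReal ω) (w s.toNNReal ω)

/-- The gain-scheduled state feedback `u = K(ρ)x`. -/
def feedback (K : S.param → Matrix (Fin m) (Fin n) ℝ) (ρ : ℝ≥0 → Ω → S.param)
    (x : ℝ≥0 → Ω → EuclideanSpace ℝ (Fin n)) : ℝ≥0 → Ω → EuclideanSpace ℝ (Fin m) :=
  fun t ω => (K (ρ t ω)).toEuclideanLin (x t ω)

/-- The norm `(∫₀^∞ 𝔼 ‖w(s)‖² ds)^{1/2} ∈ [0, ∞]` of a stochastic signal. -/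
def l2Norm {k : ℕ} (μ : Measure Ω) (w : ℝ≥0 → Ω → EuclideanSpace ℝ (Fin k)) : ℝ≥0∞ :=
  (∫⁻ s in Set.Ici (0 : ℝ), ∫⁻ ω, ‖w s.toNNReal ω‖ₑ ^ 2 ∂μ) ^ (1 / 2 : ℝ)

/-- A run of the closed loop with feedback `u = K(ρ)x`, zero initial state and a non-anticipating
disturbance `w` of `L₂`-norm one; `ρ₀` is the initial parameter and `x` the state. -/
structure IsUnitRun (K : S.param → Matrix (Fin m) (Fin n) ℝ) (μ : Measure Ω)
    (ℱ : Filtration ℝ≥0 mΩ) (ρ₀ : S.param) (ρ : ℝ≥0 → Ω → S.param)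
    (w : ℝ≥0 → Ω → EuclideanSpace ℝ (Fin p)) (x : ℝ≥0 → Ω → EuclideanSpace ℝ (Fin n)) :
    Prop where
  isProbabilityMeasure : IsProbabilityMeasure μ
  parameter : S.IsParameterEvolution μ ℱ ρ₀ ρ
  progressive : IsStronglyProgressive ℱ w
  norm_eq_one : l2Norm μ w = 1
  state : S.IsState μ ℱ ρ 0 (feedback S K ρ x) w x

end Stochastic

/-- Mean-square stability of the closed loop with `u = K(ρ)x` and `w = 0`: `𝔼 ‖x(t)‖² → 0` for
every initial condition `(x₀, ρ₀)`. -/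
def MeanSquareStable (K : S.param → Matrix (Fin m) (Fin n) ℝ) : Prop :=
  ∀ (Ω : Type u) (mΩ : MeasurableSpace Ω) (μ : Measure Ω) (ℱ : Filtration ℝ≥0 mΩ)
    (ρ : ℝ≥0 → Ω → S.param) (x : ℝ≥0 → Ω → EuclideanSpace ℝ (Fin n))
    (x₀ : EuclideanSpace ℝ (Fin n)) (ρ₀ : S.param),
    IsProbabilityMeasure μ → S.IsParameterEvolution μ ℱ ρ₀ ρ →
    S.IsState μ ℱ ρ x₀ (feedback S K ρ x) (fun _ _ => 0) x →
    Tendsto (fun t => ∫⁻ ω, ‖x t ω‖ₑ ^ 2 ∂μ) atTop (𝓝 0)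

/-- The `L₂`-gain `sup_{‖w‖ = 1} ‖z‖ ∈ [0, ∞]` of the map `w ↦ z` of the closed loop with
`u = K(ρ)x` and `x₀ = 0`. -/
def l2Gain (K : S.param → Matrix (Fin m) (Fin n) ℝ) : ℝ≥0∞ :=
  ⨆ (Ω : Type u) (mΩ : MeasurableSpace Ω) (μ : Measure Ω) (ℱ : Filtration ℝ≥0 mΩ) (ρ₀ : S.param)
    (ρ : ℝ≥0 → Ω → S.param) (w : ℝ≥0 → Ω → EuclideanSpace ℝ (Fin p))
    (x : ℝ≥0 → Ω → EuclideanSpace ℝ (Fin n)) (_ : S.IsUnitRun K μ ℱ ρ₀ ρ w x),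
    l2Norm μ fun t ω => S.output (ρ t ω) (x t ω) (feedback S K ρ x t ω) (w t ω)

/-- The block matrix of the synthesis condition at `(ρ, θ)`; its block rows and columns have the
sizes `n`, `p`, `q`, `n`, and `volume.real S.param` is the Lebesgue measure of `𝒫`. -/
def synthesisMatrix (γ : ℝ) (Q : S.param → Matrix (Fin n) (Fin n) ℝ)
    (U : S.param → Matrix (Fin m) (Fin n) ℝ) (Z : S.param → S.param → Matrix (Fin n) (Fin n) ℝ)
    (ρ θ : S.param) :
    Matrix ((Fin n ⊕ Fin p) ⊕ (Fin q ⊕ Fin n)) ((Fin n ⊕ Fin p) ⊕ (Fin q ⊕ Fin n)) ℝ :=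
  let M := S.A ρ * Q ρ + S.B ρ * U ρ
  let L := S.C ρ * Q ρ + S.D ρ * U ρ
  let R := (volume.real S.param * √(S.rate ρ θ)) • Q ρ
  Matrix.fromBlocks
    (Matrix.fromBlocks (M + Mᵀ - S.intensity ρ • Q ρ + Z ρ θ) (S.E ρ)
      (S.E ρ)ᵀ (-(γ ^ 2) • 1))
    (Matrix.fromBlocks Lᵀ R (S.F ρ)ᵀ 0)
    (Matrix.fromBlocks L (S.F ρ) Rᵀ 0)
    (Matrix.fromBlocks (-1) 0 0 (-(volume.real S.param) • Q θ))

end LPVSystem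

end

/-! The Lyapunov function is V(ρ, x) = xᵀ Q(ρ)⁻¹ x, and along the closed loop its generator is LV =
2 (Q(ρ)⁻¹x)ᵀ ẋ + ∫ λ(ρ, θ) (V(θ, x) - V(ρ, x)) dθ. Evaluating the matrix inequality at (Q(ρ)⁻¹x, w,
z, λ(ρ, θ)^{1/2} Q(θ)⁻¹x) performs the congruence with Q(ρ)⁻¹ and both Schur complements at once
(`dotProduct_synthesisMatrix_eq_dissipation`). Integrating over θ removes Z and gives LV + ‖z‖² ≤
γ²‖w‖² (`lyapunovDrift_add_le`). For w = 0 the inequality is strict off x = 0, and compactness gives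
LV ≤ -ε‖x‖² (`exists_lyapunovDrift_le`).

Dynkin's formula 𝔼 V(T) = V(0) + 𝔼 ∫₀ᵀ LV (`integral_lyapunov_eq`) then yields both claims: 𝔼 V is
nonincreasing with ε 𝔼 ∫₀ᵀ ‖x‖² ≤ V(0), hence is O(1/T) when w = 0; and V(0) = 0 ≤ 𝔼 V(T) bounds the
output energy when x₀ = 0.

Dynkin's formula needs no stochastic integral. V is a sum of products of xᵢxⱼ, pathwise absolutely
continuous, and an entry of Q(ρ)⁻¹, a continuous f of the parameter. For such products
(`integral_mul_eq_add_integral`) the pathwise product rule and the martingale f(ρ(t)) - ∫ Lf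
suffice. The martingale comes from the forward equation (`integral_mul_comp_eq`). The jump rates are
prescribed only pointwise in ρ, without uniformity; subadditivity of the exit probability gives the
uniform bound `real_compl_le`, which allows differentiation under the expectation. The required
second moments follow from Grönwall's inequality (`exists_norm_sq_le`). -/

/-! ### Integrals against setwise convergent measures. -/

/-- Setwise convergence of finite measures implies convergence of the integrals of bounded
measurable functions. -/
theorem tendsto_integral_of_tendsto_measureReal {α ι : Type*} [MeasurableSpace α] {l : Filter ι}
    [l.IsCountablyGenerated] {ν : ι → Measure α} [∀ i, IsFiniteMeasure (ν i)] {κ : Measure α}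
    [IsFiniteMeasure κ]
    (h : ∀ s, MeasurableSet s → Tendsto (fun i => (ν i).real s) l (𝓝 (κ.real s)))
    {f : α → ℝ} (hf : Measurable f) {c : ℝ} (hc : ∀ x, |f x| ≤ c) :
    Tendsto (fun i => ∫ x, f x ∂ν i) l (𝓝 (∫ x, f x ∂κ)) := by
  have hint : ∀ (η : Measure α) [IsFiniteMeasure η], Integrable f η := fun η _ =>
    Integrable.of_bound hf.aestronglyMeasurable c (.of_forall hc)
  -- Layer cake: f + c takes values in [0, 2c], so its integral is that of the tail measures over
  -- (0, 2c]. Each tail converges by `h`, and dominated convergence in the level t finishes.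
  have key : ∀ (η : Measure α) [IsFiniteMeasure η],
      ∫ x, f x ∂η = (∫ t in Set.Ioc 0 (2 * c), η.real {a | t ≤ f a + c}) - c * η.real .univ := by
    intro η _
    have h1 := Integrable.integral_eq_integral_Ioc_meas_le (μ := η) (M := 2 * c)
      ((hint η).add (integrable_const c))
      (.of_forall fun x => by have := abs_le.1 (hc x); simp; linarith)
      (.of_forall fun x => by have := abs_le.1 (hc x); simp; linarith)
    simp only [Pi.add_apply] at h1
    rw [← h1, integral_add (hint η) (integrable_const c)]
    simp [mul_comm]
  simp_rw [key _]
  refine Tendsto.sub ?_ ((h _ .univ).const_mul c)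
  have hm : ∀ t, MeasurableSet {a | t ≤ f a + c} := fun t =>
    measurableSet_le measurable_const (hf.add_const c)
  refine tendsto_integral_filter_of_dominated_convergence (fun _ => κ.real .univ + 1) ?_ ?_
    (integrable_const _) (.of_forall fun t => h _ (hm t))
  · refine .of_forall fun i => Measurable.aestronglyMeasurable ?_
    refine Antitone.measurable fun s t hst => ?_
    exact measureReal_mono fun a (ha : t ≤ _) => hst.trans ha
  · filter_upwards [(h _ .univ).eventually (gt_mem_nhds (lt_add_one _))] with i hi
    refine .of_forall fun t => ?_
    rw [Real.norm_of_nonneg measureReal_nonneg]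
    exact (measureReal_mono (Set.subset_univ _)).trans hi.le

/-! ### The parameter space and the generator of the jump process. -/

namespace LPVSystem

variable {N n m p q : ℕ} {S : LPVSystem N n m p q}

instance : CompactSpace S.param := isCompact_iff_compactSpace.1 S.isCompact

theorem measurableSet_param : MeasurableSet S.param := S.isCompact.isClosed.measurableSet

theorem lebesgue_univ : S.lebesgue Set.univ = volume S.param := by
  rw [lebesgue, Measure.comap_apply _ Subtype.val_injective
    (fun s hs => measurableSet_param.subtype_image hs) _ .univ, Set.image_univ, Subtype.range_val]

instance : IsFiniteMeasure S.lebesgue :=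
  ⟨by rw [lebesgue_univ]; exact S.isCompact.measure_lt_top⟩

theorem exists_abs_le {f : S.param → ℝ} (hf : Continuous f) : ∃ c, 0 ≤ c ∧ ∀ ρ, |f ρ| ≤ c := by
  obtain ⟨c, hc⟩ := isCompact_univ.exists_bound_of_continuousOn hf.continuousOn
  exact ⟨|c|, abs_nonneg _, fun ρ => (hc ρ trivial).trans (le_abs_self c)⟩

theorem continuous_rate_right (ρ : S.param) : Continuous (S.rate ρ) :=
  S.continuous_rate.comp (Continuous.prodMk_right ρ)

theorem integrable_of_continuous {f : S.param → ℝ} (hf : Continuous f) :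
    Integrable f S.lebesgue := by
  obtain ⟨c, -, hc⟩ := exists_abs_le hf
  exact .of_bound hf.aestronglyMeasurable c (.of_forall hc)

theorem continuous_integral {f : S.param → S.param → ℝ}
    (hf : Continuous fun r : S.param × S.param => f r.1 r.2) :
    Continuous fun ρ => ∫ θ, f ρ θ ∂S.lebesgue := by
  simpa using continuous_parametric_integral_of_continuous (μ := S.lebesgue) (f := f) hf
    isCompact_univ

theorem continuous_intensity : Continuous S.intensity := continuous_integral S.continuous_rate

/-- The generator `f ↦ ∫ rate ρ θ (f θ - f ρ) dθ` of the parameter process. -/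
noncomputable def generator (S : LPVSystem N n m p q) (f : S.param → ℝ) (ρ : S.param) : ℝ :=
  ∫ θ, S.rate ρ θ * (f θ - f ρ) ∂S.lebesgue

theorem continuous_generator {f : S.param → ℝ} (hf : Continuous f) :
    Continuous (S.generator f) :=
  continuous_integral (S.continuous_rate.mul
    ((hf.comp continuous_snd).sub (hf.comp continuous_fst)))

/-! ### Small-time behaviour of the transition function. -/

namespace IsTransitionFunction

variable {P : ℝ≥0 → Kernel S.param S.param}

/-- To be away from ρ at time s + h, the process must either be away at time s or be at ρ then and
away after a further time h. -/
theorem apply_add_le (hP : S.IsTransitionFunction P) (ρ : S.param) (s h : ℝ≥0) :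
    P (s + h) ρ {ρ}ᶜ ≤ P s ρ {ρ}ᶜ + P h ρ {ρ}ᶜ := by
  have := hP.markov
  have hm : MeasurableSet ({ρ}ᶜ : Set S.param) := (measurableSet_singleton ρ).compl
  rw [hP.chapman_kolmogorov, Kernel.comp_apply' _ _ _ hm]
  calc ∫⁻ y, P h y {ρ}ᶜ ∂P s ρ
      ≤ ∫⁻ y, (({ρ}ᶜ : Set S.param).indicator 1 y + P h ρ {ρ}ᶜ) ∂P s ρ := by
        refine lintegral_mono fun y => ?_
        by_cases hy : y = ρ
        · simp [hy]
        · have : y ∈ ({ρ}ᶜ : Set S.param) := hy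
          simp only [Set.indicator_of_mem this, Pi.one_apply]
          exact prob_le_one.trans le_self_add
    _ = _ := by
        rw [lintegral_add_left (measurable_one.indicator hm), lintegral_indicator_one hm]
        simp

theorem real_nsmul_le (hP : S.IsTransitionFunction P) (ρ : S.param) (h : ℝ≥0) (k : ℕ) :
    (P (k * h) ρ).real {ρ}ᶜ ≤ k * (P h ρ).real {ρ}ᶜ := by
  have := hP.markov
  induction k with
  | zero => simp [hP.zero, Kernel.id_apply, measureReal_def]
  | succ k ih =>
    have h1 : (P (k * h + h) ρ).real {ρ}ᶜ ≤ (P (k * h) ρ).real {ρ}ᶜ + (P h ρ).real {ρ}ᶜ := by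
      simp only [measureReal_def]
      rw [← ENNReal.toReal_add (measure_ne_top _ _) (measure_ne_top _ _)]
      exact ENNReal.toReal_mono (by simp) (hP.apply_add_le ρ _ h)
    push_cast
    rw [add_mul, one_mul]
    linarith

theorem tendsto_real_div (hP : S.IsTransitionFunction P) {ρ : S.param} {Λ : Set S.param}
    (hΛ : MeasurableSet Λ) (hρ : ρ ∉ Λ) :
    Tendsto (fun h : ℝ≥0 => (P h ρ).real Λ / h) (𝓝[>] 0)
      (𝓝 (∫ θ in Λ, S.rate ρ θ ∂S.lebesgue)) := by
  have h1 := ((hP.infinitesimal ρ Λ hΛ hρ).tendsto_div_nhds_zero).add_const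
    (∫ θ in Λ, S.rate ρ θ ∂S.lebesgue)
  rw [zero_add] at h1
  refine h1.congr' ?_
  filter_upwards [self_mem_nhdsWithin] with h hh
  have : (h : ℝ) ≠ 0 := by simpa using (Set.mem_Ioi.1 hh).ne'
  field_simp
  ring

/-- The probability of leaving a state is bounded by the intensity, uniformly in time. -/
theorem real_compl_le (hP : S.IsTransitionFunction P) (ρ : S.param) (h : ℝ≥0) :
    (P h ρ).real {ρ}ᶜ ≤ S.intensity ρ * h := by
  have := hP.markov
  rcases eq_or_ne h 0 with rfl | hh
  · simp [hP.zero, Kernel.id_apply, measureReal_def]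
  have hint : ∫ θ in {ρ}ᶜ, S.rate ρ θ ∂S.lebesgue ≤ S.intensity ρ :=
    setIntegral_le_integral (integrable_of_continuous (continuous_rate_right ρ))
      (.of_forall (S.rate_nonneg ρ))
  have hpos : 0 < (h : ℝ) := by positivity
  -- Split h into k + 1 equal steps. Subadditivity bounds the exit probability by h times the
  -- difference quotient at step length h / (k + 1), whose limit is the rate off ρ.
  have hk : Tendsto (fun k : ℕ => h / ((k : ℝ≥0) + 1)) atTop (𝓝[>] 0) := by
    refine tendsto_nhdsWithin_iff.2 ⟨?_, .of_forall fun k => ?_⟩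
    · rw [← NNReal.tendsto_coe]
      simpa [div_eq_mul_inv] using (tendsto_one_div_add_atTop_nhds_zero_nat (𝕜 := ℝ)).const_mul (h : ℝ)
    · exact Set.mem_Ioi.2 (by positivity)
  have h1 := ((hP.tendsto_real_div (ρ := ρ) (Λ := {ρ}ᶜ) (measurableSet_singleton ρ).compl
    (by simp)).comp hk).mul_const (h : ℝ)
  refine (ge_of_tendsto' h1 fun k => ?_).trans (mul_le_mul_of_nonneg_right hint h.2)
  have h2 := hP.real_nsmul_le ρ (h / ((k : ℝ≥0) + 1)) (k + 1)
  have h3 : ((k + 1 : ℕ) : ℝ≥0) * (h / ((k : ℝ≥0) + 1)) = h := by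
    push_cast
    field_simp
  rw [h3] at h2
  refine h2.trans (le_of_eq ?_)
  simp only [Function.comp]
  push_cast
  field_simp

/-- The integrand f - f(ρ) vanishes at ρ and is at most 2c elsewhere. The bound is linear in h and
uniform in ρ once the intensity is bounded, so it dominates the difference quotients of the
semigroup. -/
theorem abs_integral_sub_le (hP : S.IsTransitionFunction P) (ρ : S.param) (h : ℝ≥0)
    {f : S.param → ℝ} (hf : Measurable f) {c : ℝ} (hc : ∀ x, |f x| ≤ c) :
    |∫ θ, f θ ∂P h ρ - f ρ| ≤ 2 * c * (S.intensity ρ * h) := by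
  have := hP.markov
  have hi : Integrable f (P h ρ) := .of_bound hf.aestronglyMeasurable c (.of_forall hc)
  have h1 : ∫ θ, f θ ∂P h ρ - f ρ = ∫ θ in {ρ}ᶜ, (f θ - f ρ) ∂P h ρ := by
    rw [setIntegral_eq_integral_of_forall_compl_eq_zero (by simp +contextual),
      integral_sub hi (integrable_const _)]
    simp
  rw [h1]
  have h0 : 0 ≤ c := (abs_nonneg _).trans (hc ρ)
  have h2 : ‖∫ θ in {ρ}ᶜ, (f θ - f ρ) ∂P h ρ‖ ≤ 2 * c * (P h ρ).real {ρ}ᶜ :=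
    norm_setIntegral_le_of_norm_le_const (measure_lt_top _ _) fun x _ =>
      (norm_sub_le _ _).trans (by simpa only [Real.norm_eq_abs, two_mul] using add_le_add (hc x) (hc ρ))
  exact h2.trans (mul_le_mul_of_nonneg_left (hP.real_compl_le ρ h) (by positivity))

/-- Off ρ, the measures h⁻¹ P_h(ρ, ·) converge setwise to the jump rate. Their mass at ρ blows up,
but f - f(ρ) vanishes there, so both sides may be restricted to the complement of ρ. -/
theorem tendsto_integral_sub_div (hP : S.IsTransitionFunction P) (ρ : S.param)
    {f : S.param → ℝ} (hf : Measurable f) {c : ℝ} (hc : ∀ x, |f x| ≤ c) :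
    Tendsto (fun h : ℝ≥0 => (∫ θ, f θ ∂P h ρ - f ρ) / h) (𝓝[>] 0) (𝓝 (S.generator f ρ)) := by
  have := hP.markov
  set g : S.param → ℝ≥0 := fun θ => (S.rate ρ θ).toNNReal with hg
  have hgm : Measurable g := (continuous_rate_right ρ).measurable.real_toNNReal
  have hgc : ∀ θ, (g θ : ℝ) = S.rate ρ θ := fun θ => Real.coe_toNNReal _ (S.rate_nonneg ρ θ)
  set κ : Measure S.param := (S.lebesgue.withDensity fun θ => (g θ : ℝ≥0∞)).restrict {ρ}ᶜ with hκ
  set ν : ℝ≥0 → Measure S.param := fun h => h⁻¹ • (P h ρ).restrict {ρ}ᶜ with hν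
  have hgi : Integrable (fun θ => (g θ : ℝ)) S.lebesgue := by
    simp_rw [hgc]; exact integrable_of_continuous (continuous_rate_right ρ)
  have hfin : IsFiniteMeasure (S.lebesgue.withDensity fun θ => (g θ : ℝ≥0∞)) := by
    refine isFiniteMeasure_withDensity ?_
    have := hgi.2
    simp only [HasFiniteIntegral, ← ofReal_norm, NNReal.norm_eq] at this
    simpa using this.ne
  have hmc : MeasurableSet ({ρ}ᶜ : Set S.param) := (measurableSet_singleton ρ).compl
  have hset : ∀ s, MeasurableSet s → Tendsto (fun h => (ν h).real s) (𝓝[>] 0) (𝓝 (κ.real s)) := by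
    intro s hs
    have h1 := hP.tendsto_real_div (ρ := ρ) (hs.inter hmc) (by simp)
    have h2 : κ.real s = ∫ θ in s ∩ {ρ}ᶜ, S.rate ρ θ ∂S.lebesgue := by
      rw [hκ, measureReal_restrict_apply hs, measureReal_def, withDensity_apply _ (hs.inter hmc)]
      simp_rw [← hgc]
      rw [integral_eq_lintegral_of_nonneg_ae (f := fun θ => (g θ : ℝ)) (.of_forall fun θ => (g θ).2)
        hgi.aestronglyMeasurable.restrict]
      simp
    rw [h2]
    refine h1.congr fun h => ?_
    rw [hν, measureReal_nnreal_smul_apply, measureReal_restrict_apply hs, div_eq_inv_mul,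
      NNReal.coe_inv]
  have h3 := tendsto_integral_of_tendsto_measureReal hset (f := fun θ => f θ - f ρ)
    (hf.sub_const _) (c := 2 * c)
    (fun θ => (norm_sub_le (f θ) (f ρ)).trans (by
      simpa only [Real.norm_eq_abs, two_mul] using
        add_le_add (hc θ) (hc ρ)))
  have h4 : ∫ θ, (f θ - f ρ) ∂κ = S.generator f ρ := by
    rw [hκ, setIntegral_eq_integral_of_forall_compl_eq_zero (by simp +contextual),
      integral_withDensity_eq_integral_smul hgm]
    simp [generator, NNReal.smul_def, hgc]
  rw [h4] at h3
  refine h3.congr fun h => ?_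
  have hi : Integrable f (P h ρ) := .of_bound hf.aestronglyMeasurable c (.of_forall hc)
  simp only [hν]
  rw [integral_smul_nnreal_measure,
    setIntegral_eq_integral_of_forall_compl_eq_zero (by simp +contextual),
    integral_sub hi (integrable_const _)]
  simp [NNReal.smul_def, div_eq_inv_mul]

end IsTransitionFunction

end LPVSystem

/-! ### The Markov property and the forward equation. -/

namespace LPVSystem

variable {N n m p q : ℕ} {S : LPVSystem N n m p q} {Ω : Type u} {mΩ : MeasurableSpace Ω}
  {μ : Measure Ω} {ℱ : Filtration ℝ≥0 mΩ} {ρ₀ : S.param} {ρ : ℝ≥0 → Ω → S.param}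

namespace IsParameterEvolution

theorem measurable (hρ : S.IsParameterEvolution μ ℱ ρ₀ ρ) (t : ℝ≥0) : Measurable (ρ t) :=
  (hρ.adapted t).mono (ℱ.le t) le_rfl

/-- The Markov property for bounded measurable functions of the parameter. -/
theorem integral_mul_comp_add [IsProbabilityMeasure μ] (hρ : S.IsParameterEvolution μ ℱ ρ₀ ρ)
    {P : ℝ≥0 → Kernel S.param S.param} (hP : S.IsTransitionFunction P)
    (hmarkov : ∀ (s h : ℝ≥0) (Λ : Set S.param), MeasurableSet Λ →
      μ[(ρ (s + h) ⁻¹' Λ).indicator (fun _ => (1 : ℝ)) | ℱ s]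
        =ᵐ[μ] fun ω => (P h (ρ s ω)).real Λ)
    (s h : ℝ≥0) {Y : Ω → ℝ} (hY : StronglyMeasurable[ℱ s] Y) (hYi : Integrable Y μ)
    {f : S.param → ℝ} (hf : Measurable f) {c : ℝ} (hc : ∀ x, |f x| ≤ c) :
    ∫ ω, Y ω * f (ρ (s + h) ω) ∂μ = ∫ ω, Y ω * ∫ θ, f θ ∂P h (ρ s ω) ∂μ := by
  have := hP.markov
  have hi : ∀ t, Integrable (fun ω => f (ρ t ω)) μ := fun t =>
    .of_bound (hf.comp (hρ.measurable t)).aestronglyMeasurable c (.of_forall fun ω => hc _)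
  have hPf : StronglyMeasurable fun x => ∫ θ, f θ ∂P h x := hf.stronglyMeasurable.integral_kernel
  have hPc : ∀ x, ‖∫ θ, f θ ∂P h x‖ ≤ c := fun x => by
    simpa using norm_integral_le_of_norm_le_const (μ := P h x) (f := f) (C := c) (.of_forall hc)
  have hPm : StronglyMeasurable[ℱ s] fun ω => ∫ θ, f θ ∂P h (ρ s ω) :=
    hPf.comp_measurable (hρ.adapted s)
  have hPi : Integrable (fun ω => ∫ θ, f θ ∂P h (ρ s ω)) μ :=
    .of_bound (hPm.mono (ℱ.le s)).aestronglyMeasurable c (.of_forall fun ω => hPc _)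
  have hset : ∀ A, MeasurableSet[ℱ s] A →
      ∫ ω in A, ∫ θ, f θ ∂P h (ρ s ω) ∂μ = ∫ ω in A, f (ρ (s + h) ω) ∂μ := by
    intro A hA
    -- The Markov property for sets is an identity between laws restricted to A. Integrating f
    -- against both sides avoids an approximation by simple functions.
    have hmap : (μ.restrict A).map (ρ (s + h)) = ((μ.restrict A).map (ρ s)).bind (P h) := by
      ext Λ hΛ
      rw [Measure.bind_apply hΛ (P h).aemeasurable,
        lintegral_map ((P h).measurable_coe hΛ) (hρ.measurable s),
        Measure.map_apply (hρ.measurable _) hΛ]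
      have h1 := setIntegral_condExp (μ := μ) (ℱ.le s)
        ((integrable_const (1 : ℝ)).indicator (hρ.measurable (s + h) hΛ)) hA
      rw [setIntegral_congr_ae (ℱ.le s A hA) ((hmarkov s h Λ hΛ).mono fun _ hω _ => hω),
        integral_indicator_const _ (hρ.measurable _ hΛ)] at h1
      rw [← ENNReal.toReal_eq_toReal_iff' (measure_ne_top _ _)]
      · rw [← integral_toReal (f := fun ω => P h (ρ s ω) Λ) ((P h).measurable_coe hΛ |>.comp (hρ.measurable s)).aemeasurable
          (.of_forall fun _ => measure_lt_top _ _)]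
        simpa [measureReal_def] using h1.symm
      · refine ne_top_of_le_ne_top (measure_ne_top (μ.restrict A) .univ) ?_
        rw [← lintegral_one]
        exact lintegral_mono fun _ => prob_le_one
    have h2 : ∫ ω in A, f (ρ (s + h) ω) ∂μ = ∫ x, f x ∂(μ.restrict A).map (ρ (s + h)) :=
      (integral_map (hρ.measurable _).aemeasurable hf.aestronglyMeasurable).symm
    have h3 : ∫ ω in A, ∫ θ, f θ ∂P h (ρ s ω) ∂μ
        = ∫ x, ∫ θ, f θ ∂P h x ∂(μ.restrict A).map (ρ s) :=
      (integral_map (hρ.measurable _).aemeasurable hPf.aestronglyMeasurable).symm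
    rw [h2, h3, hmap]
    have h4 := Kernel.integral_comp (κ := Kernel.const Unit ((μ.restrict A).map (ρ s)))
      (η := P h) (a := ()) (f := f)
      (.of_bound hf.aestronglyMeasurable c (.of_forall hc))
    simpa [Kernel.comp_apply] using h4.symm
  have hcond : (fun ω => ∫ θ, f θ ∂P h (ρ s ω)) =ᵐ[μ] μ[fun ω => f (ρ (s + h) ω) | ℱ s] :=
    ae_eq_condExp_of_forall_setIntegral_eq (ℱ.le s) (hi _) (fun _ _ _ => hPi.integrableOn)
      (fun A hA _ => hset A hA) hPm.aestronglyMeasurable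
  have hYf : Integrable (Y * fun ω => f (ρ (s + h) ω)) μ :=
    hYi.mul_bdd (c := c) (hi _).aestronglyMeasurable (.of_forall fun ω => hc _)
  have h5 := condExp_mul_of_stronglyMeasurable_left hY hYf (hi _)
  have h6 := integral_condExp (μ := μ) (f := Y * fun ω => f (ρ (s + h) ω)) (ℱ.le s)
  simp only [Pi.mul_apply] at h6
  rw [← h6]
  refine integral_congr_ae ?_
  filter_upwards [h5, hcond] with ω h7 h8
  rw [h7, Pi.mul_apply, ← h8]

/-- The Kolmogorov forward equation of the parameter, weighted by a random variable that is known
at the initial time. -/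
theorem integral_mul_comp_eq [IsProbabilityMeasure μ] (hρ : S.IsParameterEvolution μ ℱ ρ₀ ρ)
    {s T : ℝ≥0} (hsT : s ≤ T) {Y : Ω → ℝ} (hY : StronglyMeasurable[ℱ s] Y) (hYi : Integrable Y μ)
    {f : S.param → ℝ} (hf : Continuous f) :
    ∫ ω, Y ω * f (ρ T ω) ∂μ = ∫ ω, Y ω * f (ρ s ω) ∂μ +
      ∫ r in (s : ℝ)..T, ∫ ω, Y ω * S.generator f (ρ r.toNNReal ω) ∂μ := by
  obtain ⟨P, hP, hmarkov⟩ := hρ.markov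
  have := hP.markov
  obtain ⟨M, hM0, hM⟩ := exists_abs_le (S := S) continuous_intensity
  have hYr : ∀ r : ℝ≥0, s ≤ r → StronglyMeasurable[ℱ r] Y := fun r hr => hY.mono (ℱ.mono hr)
  have hint : ∀ {g : S.param → ℝ}, Continuous g → ∀ r, Integrable (fun ω => Y ω * g (ρ r ω)) μ := by
    intro g hg r
    obtain ⟨c, -, hc⟩ := exists_abs_le hg
    exact hYi.mul_bdd (c := c) (hg.measurable.comp (hρ.measurable r)).aestronglyMeasurable
      (.of_forall fun ω => hc _)
  have hPm : ∀ {g : S.param → ℝ}, Continuous g → ∀ h, Measurable fun x => ∫ θ, g θ ∂P h x :=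
    fun hg h => (hg.measurable.stronglyMeasurable.integral_kernel (κ := P h)).measurable
  have hPi : ∀ {g : S.param → ℝ}, Continuous g → ∀ r h,
      Integrable (fun ω => Y ω * ∫ θ, g θ ∂P h (ρ r ω)) μ := by
    intro g hg r h
    obtain ⟨c, -, hc⟩ := exists_abs_le hg
    refine hYi.mul_bdd (c := c) ((hPm hg h).comp (hρ.measurable r)).aestronglyMeasurable
      (.of_forall fun ω => ?_)
    simpa using norm_integral_le_of_norm_le_const (μ := P h (ρ r ω)) (f := g) (C := c) (.of_forall hc)
  have hdiff : ∀ {g : S.param → ℝ}, Continuous g → ∀ r h : ℝ≥0, s ≤ r →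
      ∫ ω, Y ω * g (ρ (r + h) ω) ∂μ - ∫ ω, Y ω * g (ρ r ω) ∂μ
        = ∫ ω, Y ω * (∫ θ, g θ ∂P h (ρ r ω) - g (ρ r ω)) ∂μ := by
    intro g hg r h hr
    obtain ⟨c, -, hc⟩ := exists_abs_le hg
    rw [hρ.integral_mul_comp_add hP hmarkov r h (hYr r hr) hYi hg.measurable hc,
      ← integral_sub (hPi hg r h) (hint hg r)]
    simp_rw [mul_sub]
  have hbound : ∀ {g : S.param → ℝ} {c : ℝ}, 0 ≤ c → Continuous g → (∀ x, |g x| ≤ c) →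
      ∀ (r h : ℝ≥0) ω, ‖Y ω * (∫ θ, g θ ∂P h (ρ r ω) - g (ρ r ω))‖ ≤ ‖Y ω‖ * (2 * c * (M * h)) := by
    intro g c hc0 hg hc r h ω
    rw [norm_mul]
    refine mul_le_mul_of_nonneg_left
      ((hP.abs_integral_sub_le _ h hg.measurable hc).trans ?_) (norm_nonneg _)
    gcongr
    exact (le_abs_self _).trans (hM _)
  have hcont : ∀ {g : S.param → ℝ}, Continuous g →
      ContinuousOn (fun r : ℝ => ∫ ω, Y ω * g (ρ r.toNNReal ω) ∂μ) (Set.Icc s T) := by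
    intro g hg
    obtain ⟨c, hc0, hc⟩ := exists_abs_le hg
    set L : ℝ := (∫ ω, ‖Y ω‖ ∂μ) * (2 * c * M)
    have hL : 0 ≤ L := by positivity
    have hlip : ∀ a b : ℝ, s ≤ a → a ≤ b → |∫ ω, Y ω * g (ρ b.toNNReal ω) ∂μ
        - ∫ ω, Y ω * g (ρ a.toNNReal ω) ∂μ| ≤ L * (b - a) := by
      intro a b ha hab
      have hb : b.toNNReal = a.toNNReal + (b - a).toNNReal := by
        rw [← Real.toNNReal_add (s.2.trans ha) (by linarith)]; congr 1; ring
      rw [hb, hdiff hg _ _ (NNReal.le_toNNReal_of_coe_le ha)]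
      refine (norm_integral_le_of_norm_le (hYi.norm.mul_const _)
        (.of_forall fun ω => hbound hc0 hg hc a.toNNReal (b - a).toNNReal ω)).trans (le_of_eq ?_)
      rw [integral_mul_const, Real.coe_toNNReal _ (by linarith)]
      ring
    refine (LipschitzOnWith.of_dist_le_mul (K := L.toNNReal) fun a ha b hb => ?_).continuousOn
    rw [Real.coe_toNNReal _ hL]
    rcases le_total a b with hab | hab
    · rw [dist_comm, dist_comm a, Real.dist_eq, Real.dist_eq, abs_of_nonneg (sub_nonneg.2 hab)]
      exact hlip a b ha.1 hab
    · rw [Real.dist_eq, Real.dist_eq, abs_of_nonneg (sub_nonneg.2 hab)]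
      exact hlip b a hb.1 hab
  -- The Markov property looks forward in time, so only the right derivative is accessible. Together
  -- with continuity this is enough for the fundamental theorem of calculus.
  have hderiv : ∀ r ∈ Set.Ioo (s : ℝ) T,
      HasDerivWithinAt (fun r : ℝ => ∫ ω, Y ω * f (ρ r.toNNReal ω) ∂μ)
        (∫ ω, Y ω * S.generator f (ρ r.toNNReal ω) ∂μ) (Set.Ioi r) r := by
    intro r hr
    obtain ⟨c, hc0, hc⟩ := exists_abs_le hf
    have hr0 : 0 ≤ r := s.2.trans hr.1.le
    have hsr : s ≤ r.toNNReal := NNReal.le_toNNReal_of_coe_le hr.1.le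
    rw [hasDerivWithinAt_iff_tendsto_slope' (by simp)]
    have hlim : Tendsto (fun h : ℝ≥0 => ∫ ω, Y ω *
        ((∫ θ, f θ ∂P h (ρ r.toNNReal ω) - f (ρ r.toNNReal ω)) / h) ∂μ) (𝓝[>] 0)
        (𝓝 (∫ ω, Y ω * S.generator f (ρ r.toNNReal ω) ∂μ)) := by
      refine tendsto_integral_filter_of_dominated_convergence
        (fun ω => ‖Y ω‖ * (2 * c * M)) (.of_forall fun h => ?_) ?_ (hYi.norm.mul_const _)
        (.of_forall fun ω => (hP.tendsto_integral_sub_div _ hf.measurable hc).const_mul _)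
      · exact hYi.aestronglyMeasurable.mul ((((hPm hf h).sub hf.measurable).comp
          (hρ.measurable _)).div_const _).aestronglyMeasurable
      · filter_upwards [self_mem_nhdsWithin] with h hh
        have hh' : (0 : ℝ) < h := by exact_mod_cast Set.mem_Ioi.1 hh
        refine .of_forall fun ω => ?_
        rw [← mul_div_assoc, norm_div, Real.norm_of_nonneg hh'.le, div_le_iff₀ hh']
        exact (hbound hc0 hf hc _ h ω).trans (le_of_eq (by ring))
    have hmap : Tendsto (fun x : ℝ => (x - r).toNNReal) (𝓝[>] r) (𝓝[>] 0) := by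
      refine tendsto_nhdsWithin_iff.2 ⟨?_, ?_⟩
      · have : Tendsto (fun x : ℝ => (x - r).toNNReal) (𝓝 r) (𝓝 (r - r).toNNReal) :=
          (continuous_real_toNNReal.comp (continuous_id.sub continuous_const)).tendsto r
        simpa using this.mono_left nhdsWithin_le_nhds
      · filter_upwards [self_mem_nhdsWithin] with x hx
        simpa using hx
    refine (hlim.comp hmap).congr' ?_
    filter_upwards [self_mem_nhdsWithin] with x hx
    have hx' : r < x := hx
    have hxe : x.toNNReal = r.toNNReal + (x - r).toNNReal := by
      rw [← Real.toNNReal_add hr0 (by linarith)]; congr 1; ring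
    rw [slope_def_field, hxe, hdiff hf _ _ hsr, ← integral_div]
    simp only [Function.comp, Real.coe_toNNReal _ (sub_nonneg.2 hx'.le), mul_div_assoc]
  have hsT' : (s : ℝ) ≤ T := by exact_mod_cast hsT
  have h9 := intervalIntegral.integral_eq_sub_of_hasDeriv_right_of_le hsT' (hcont hf) hderiv
    ((hcont (continuous_generator hf)).intervalIntegrable_of_Icc hsT')
  rw [h9]
  simp

end IsParameterEvolution

end LPVSystem

/-! ### Joint measurability and pathwise calculus. -/

section Pathwise

/-- The `+ 1` puts the grid point strictly to the right of t, where right-continuity applies. For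
fixed k the grid is countable, so a process sampled on it is jointly measurable. -/
theorem tendsto_floor_add_one_div (t : ℝ) :
    Tendsto (fun k : ℕ => ((⌊t * (k + 1)⌋ + 1 : ℝ)) / (k + 1)) atTop (𝓝[>] t) := by
  refine tendsto_nhdsWithin_iff.2 ⟨?_, .of_forall fun k => ?_⟩
  · have h1 : Tendsto (fun k : ℕ => t + 1 / ((k : ℝ) + 1)) atTop (𝓝 (t + 0)) :=
      tendsto_one_div_add_atTop_nhds_zero_nat.const_add t
    rw [add_zero] at h1
    refine tendsto_of_tendsto_of_tendsto_of_le_of_le tendsto_const_nhds h1 (fun k => ?_)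
      (fun k => ?_)
    · have hk : (0 : ℝ) < k + 1 := by positivity
      change t ≤ (⌊t * (k + 1)⌋ + 1 : ℝ) / (k + 1)
      rw [le_div_iff₀ hk]
      exact (Int.lt_floor_add_one _).le
    · have hk : (0 : ℝ) < k + 1 := by positivity
      change (⌊t * (k + 1)⌋ + 1 : ℝ) / (k + 1) ≤ t + 1 / (k + 1)
      rw [div_le_iff₀ hk, add_mul, one_div, inv_mul_cancel₀ hk.ne']
      linarith [Int.floor_le (t * ((k : ℝ) + 1))]
  · have hk : (0 : ℝ) < k + 1 := by positivity
    rw [Set.mem_Ioi, lt_div_iff₀ hk]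
    exact Int.lt_floor_add_one _

variable {Ω E : Type*} {mΩ : MeasurableSpace Ω} {μ : Measure Ω} [MeasurableSpace E]

theorem measurable_comp_floor {Y : ℝ → Ω → E} (hm : ∀ t, Measurable (Y t)) (k : ℕ) :
    Measurable fun z : ℝ × Ω => Y ((⌊z.1 * (k + 1)⌋ + 1 : ℝ) / (k + 1)) z.2 := by
  have h1 : Measurable fun z : ℤ × Ω => Y ((z.1 + 1 : ℝ) / (k + 1)) z.2 :=
    measurable_from_prod_countable_right fun j => hm (((j : ℝ) + 1) / (k + 1))
  exact h1.comp ((Int.measurable_floor.comp (measurable_fst.mul_const _)).prodMk measurable_snd)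

variable [TopologicalSpace E] [TopologicalSpace.PseudoMetrizableSpace E] [BorelSpace E]

/-- A right-continuous process is jointly measurable. -/
theorem measurable_uncurry_of_rightContinuous {Y : ℝ → Ω → E} (hm : ∀ t, Measurable (Y t))
    (hr : ∀ ω t, Tendsto (fun s => Y s ω) (𝓝[>] t) (𝓝 (Y t ω))) :
    Measurable fun z : ℝ × Ω => Y z.1 z.2 :=
  measurable_of_tendsto_metrizable (measurable_comp_floor hm) <| tendsto_pi_nhds.2 fun z =>
    (hr z.2 z.1).comp (tendsto_floor_add_one_div z.1)

/-- An almost surely right-continuous process is jointly almost everywhere measurable. -/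
theorem aestronglyMeasurable_uncurry_of_rightContinuous [SecondCountableTopology E]
    {Y : ℝ → Ω → E} [SFinite μ]
    (hm : ∀ t, Measurable (Y t))
    (hr : ∀ᵐ ω ∂μ, ∀ t, Tendsto (fun s => Y s ω) (𝓝[>] t) (𝓝 (Y t ω))) (ν : Measure ℝ) :
    AEStronglyMeasurable (fun z : ℝ × Ω => Y z.1 z.2) (ν.prod μ) := by
  refine aestronglyMeasurable_of_tendsto_ae atTop
    (fun k => (measurable_comp_floor hm k).stronglyMeasurable.aestronglyMeasurable) ?_
  filter_upwards [Measure.quasiMeasurePreserving_snd.ae hr] with z hz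
  exact (hz z.1).comp (tendsto_floor_add_one_div z.1)

/-- The target filter cannot be `𝓝[>]`: for t < 0 the truncation is constantly 0 near t. -/
theorem tendsto_toNNReal_nhdsGT (t : ℝ) :
    Tendsto Real.toNNReal (𝓝[>] t) (𝓝[≥] t.toNNReal) :=
  tendsto_nhdsWithin_iff.2 ⟨(continuous_real_toNNReal.tendsto t).mono_left nhdsWithin_le_nhds, by
    filter_upwards [self_mem_nhdsWithin] with s hs
    exact Real.toNNReal_mono (Set.mem_Ioi.1 hs).le⟩

/-- The product rule for indefinite integrals. -/
theorem mul_eq_integral_add {a b : ℝ → ℝ} {α β T : ℝ}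
    (ha : IntervalIntegrable a volume 0 T) (hb : IntervalIntegrable b volume 0 T) :
    (α + ∫ s in 0..T, a s) * (β + ∫ s in 0..T, b s) = α * β +
      ∫ t in 0..T, (a t * (β + ∫ s in 0..t, b s) + (α + ∫ s in 0..t, a s) * b t) := by
  have hac : ∀ {c : ℝ → ℝ} (δ : ℝ), IntervalIntegrable c volume 0 T →
      AbsolutelyContinuousOnInterval (fun t => δ + ∫ s in 0..t, c s) 0 T := fun δ hc =>
    (contDiff_const (c := δ)).contDiffOn.absolutelyContinuousOnInterval.add
      (hc.absolutelyContinuousOnInterval_intervalIntegral (c := 0) (by simp))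
  have h1 := (hac α ha).integral_deriv_mul_eq_sub (hac β hb)
  simp only [intervalIntegral.integral_same, add_zero] at h1
  rw [← sub_eq_iff_eq_add', ← h1]
  refine intervalIntegral.integral_congr_ae ?_
  filter_upwards [ha.ae_hasDerivAt_integral, hb.ae_hasDerivAt_integral] with t h2 h3 ht
  have ht' := Set.uIoc_subset_uIcc ht
  rw [((h2 ht' 0 (by simp)).const_add α).deriv, ((h3 ht' 0 (by simp)).const_add β).deriv]

/-- Grönwall's inequality in integral form. -/
theorem le_mul_exp_of_le_integral {y : ℝ → ℝ} {c K T : ℝ} (hK : 0 < K) (hy : Continuous y)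
    (h : ∀ t ∈ Set.Icc 0 T, y t ≤ c + K * ∫ s in 0..t, y s) :
    ∀ t ∈ Set.Icc 0 T, y t ≤ c * Real.exp (K * t) := by
  intro t ht
  have hd : ∀ s, HasDerivAt (fun s => ∫ r in 0..s, y r) (y s) s := fun s =>
    intervalIntegral.integral_hasDerivAt_right (hy.intervalIntegrable _ _)
      (hy.stronglyMeasurableAtFilter _ _) hy.continuousAt
  -- The differential Grönwall inequality applies to the primitive of y, which starts at 0; its
  -- bound is then inserted into the hypothesis on y.
  have h1 := le_gronwallBound_of_liminf_deriv_right_le (f := fun s => ∫ r in 0..s, y r) (f' := y)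
    (δ := 0) (K := K) (ε := c) (a := 0) (b := T)
    (fun s _ => (hd s).continuousAt.continuousWithinAt)
    (fun s _ r hr => (hd s).hasDerivWithinAt.liminf_right_slope_le hr) (by simp)
    (fun s hs => by linarith [h s ⟨hs.1, hs.2.le⟩]) t ht
  rw [gronwallBound_of_K_ne_0 hK.ne'] at h1
  have h2 := h t ht
  have h3 := mul_le_mul_of_nonneg_left h1 hK.le
  have h4 : K * (0 * Real.exp (K * (t - 0)) + c / K * (Real.exp (K * (t - 0)) - 1))
      = c * Real.exp (K * t) - c := by
    field_simp; simp
  linarith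

end Pathwise

/-! ### The martingale property and Dynkin's formula for products. -/

namespace LPVSystem

variable {N n m p q : ℕ} {S : LPVSystem N n m p q} {Ω : Type u} {mΩ : MeasurableSpace Ω}
  {μ : Measure Ω} {ℱ : Filtration ℝ≥0 mΩ} {ρ₀ : S.param} {ρ : ℝ≥0 → Ω → S.param}

namespace IsParameterEvolution

theorem measurable_uncurry (hρ : S.IsParameterEvolution μ ℱ ρ₀ ρ) :
    Measurable fun z : ℝ × Ω => ρ z.1.toNNReal z.2 := by
  refine measurable_uncurry_of_rightContinuous (Y := fun t ω => ρ t.toNNReal ω)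
    (fun t => hρ.measurable _) fun ω t => ?_
  have h1 : Tendsto (fun s => ρ s ω) (𝓝[≥] t.toNNReal) (𝓝 (ρ t.toNNReal ω)) := by
    rw [← Set.Ioi_insert, nhdsWithin_insert, tendsto_sup]
    exact ⟨tendsto_pure_nhds _ _, tendsto_const_nhds.congr' <|
      (hρ.constant_right ω _).mono fun s hs => hs.symm⟩
  exact h1.comp (tendsto_toNNReal_nhdsGT t)

/-- The martingale property of `f (ρ t) - ∫ generator f (ρ r) dr`. -/
theorem integral_mul_sub_integral [IsProbabilityMeasure μ] (hρ : S.IsParameterEvolution μ ℱ ρ₀ ρ)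
    {s T : ℝ≥0} (hsT : s ≤ T) {Y : Ω → ℝ} (hY : StronglyMeasurable[ℱ s] Y) (hYi : Integrable Y μ)
    {f : S.param → ℝ} (hf : Continuous f) :
    ∫ ω, Y ω * (f (ρ T ω) - ∫ r in (s : ℝ)..T, S.generator f (ρ r.toNNReal ω)) ∂μ
      = ∫ ω, Y ω * f (ρ s ω) ∂μ := by
  have hsT' : (s : ℝ) ≤ T := by exact_mod_cast hsT
  obtain ⟨c, -, hc⟩ := exists_abs_le hf
  obtain ⟨c', -, hc'⟩ := exists_abs_le (continuous_generator hf)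
  have hi1 : Integrable (fun ω => Y ω * f (ρ T ω)) μ :=
    hYi.mul_bdd (c := c) (hf.measurable.comp (hρ.measurable T)).aestronglyMeasurable
      (.of_forall fun ω => hc _)
  have hgm := (continuous_generator hf).measurable.comp hρ.measurable_uncurry
  have hi2 : Integrable (fun z : ℝ × Ω => Y z.2 * S.generator f (ρ z.1.toNNReal z.2))
      ((volume.restrict (Set.uIoc (s : ℝ) T)).prod μ) := by
    rw [Set.uIoc_of_le hsT']
    exact (hYi.comp_snd _).mul_bdd (c := c') hgm.aestronglyMeasurable (.of_forall fun ω => hc' _)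
  have h1 := hρ.integral_mul_comp_eq hsT hY hYi hf
  rw [intervalIntegral_integral_swap hi2] at h1
  simp only [intervalIntegral.integral_const_mul] at h1
  have hi3 : Integrable (fun ω => Y ω * ∫ r in (s : ℝ)..T, S.generator f (ρ r.toNNReal ω)) μ := by
    have := hi2.integral_prod_right
    simp only [integral_const_mul, Set.uIoc_of_le hsT'] at this
    simpa only [intervalIntegral.integral_of_le hsT'] using this
  simp only [mul_sub]
  rw [integral_sub hi1 hi3, h1]
  ring

/-- Dynkin's formula for the product of an absolutely continuous adapted process and a function
of the parameter. -/
theorem integral_mul_eq_add_integral [IsProbabilityMeasure μ]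
    (hρ : S.IsParameterEvolution μ ℱ ρ₀ ρ) (T : ℝ≥0) {X D : ℝ → Ω → ℝ} {X₀ : ℝ}
    (hDm : ∀ s, StronglyMeasurable[ℱ s.toNNReal] (D s))
    (hDi : Integrable (fun z : ℝ × Ω => D z.1 z.2) ((volume.restrict (Set.Ioc 0 (T : ℝ))).prod μ))
    (hXi : Integrable (fun z : ℝ × Ω => X z.1 z.2) ((volume.restrict (Set.Ioc 0 (T : ℝ))).prod μ))
    (hX : ∀ᵐ ω ∂μ, ∀ t ∈ Set.Icc 0 (T : ℝ), X t ω = X₀ + ∫ s in 0..t, D s ω)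
    {f : S.param → ℝ} (hf : Continuous f) :
    ∫ ω, X T ω * f (ρ T ω) ∂μ = X₀ * f ρ₀ +
      ∫ z : ℝ × Ω, (D z.1 z.2 * f (ρ z.1.toNNReal z.2)
        + X z.1 z.2 * S.generator f (ρ z.1.toNNReal z.2))
        ∂(volume.restrict (Set.Ioc 0 (T : ℝ))).prod μ := by
  set ν : Measure ℝ := volume.restrict (Set.Ioc 0 (T : ℝ)) with hν
  obtain ⟨c, hc0, hc⟩ := exists_abs_le hf
  obtain ⟨c', hc0', hc'⟩ := exists_abs_le (continuous_generator hf)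
  have hT : (0 : ℝ) ≤ T := T.2
  set G : ℝ → Ω → ℝ := fun r ω => S.generator f (ρ r.toNNReal ω) with hG
  set Γ : ℝ → Ω → ℝ := fun t ω => ∫ r in 0..t, G r ω with hΓ
  have hGm : Measurable fun z : ℝ × Ω => G z.1 z.2 :=
    (continuous_generator hf).measurable.comp hρ.measurable_uncurry
  have hGi : ∀ ω a b, IntervalIntegrable (fun r => G r ω) volume a b := fun ω a b =>
    (intervalIntegrable_const (c := c')).mono_fun
      (hGm.comp measurable_prodMk_right).aestronglyMeasurable
      (.of_forall fun r => (hc' _).trans (le_abs_self _))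
  have hΓc : ∀ ω, Continuous fun t => Γ t ω := fun ω =>
    intervalIntegral.continuous_primitive (fun a b => hGi ω a b) 0
  have hΓm : Measurable fun z : ℝ × Ω => Γ z.1 z.2 := by
    refine measurable_uncurry_of_rightContinuous (fun t => ?_)
      fun ω t => ((hΓc ω).tendsto t).mono_left nhdsWithin_le_nhds
    simp only [hΓ, intervalIntegral.intervalIntegral_eq_integral_uIoc, smul_eq_mul]
    exact (hGm.stronglyMeasurable.integral_prod_left' (μ := volume.restrict _)).measurable.const_mul _
  have hΓb : ∀ t ∈ Set.Icc 0 (T : ℝ), ∀ ω, |Γ t ω| ≤ c' * T := fun t ht ω => by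
    refine (intervalIntegral.norm_integral_le_of_norm_le_const (f := fun r => G r ω) (C := c')
      fun r _ => hc' _).trans ?_
    rw [sub_zero, abs_of_nonneg ht.1]
    exact mul_le_mul_of_nonneg_left ht.2 hc0'
  have hfm : Measurable fun z : ℝ × Ω => f (ρ z.1.toNNReal z.2) :=
    hf.measurable.comp hρ.measurable_uncurry
  have hfT : Measurable fun ω => f (ρ T ω) := hf.measurable.comp (hρ.measurable T)
  have hΓT : Measurable fun ω => Γ T ω := hΓm.comp measurable_prodMk_left
  have hMb : ∀ ω, |f (ρ T ω) - Γ T ω| ≤ c + c' * T := fun ω =>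
    (norm_sub_le (f (ρ T ω)) _).trans (add_le_add (hc _) (hΓb T ⟨hT, le_rfl⟩ ω))
  -- With M = f(ρ) - Γ, write X_T f(ρ_T) = X_T M_T + X_T Γ_T. In the first term only X is expanded
  -- as an integral and M_T is kept at the final time; the second is expanded by the product rule.
  have hpath : ∀ᵐ ω ∂μ, X T ω * f (ρ T ω) = X₀ * (f (ρ T ω) - Γ T ω) +
      ∫ s, (D s ω * (f (ρ T ω) - (Γ T ω - Γ s ω)) + X s ω * G s ω) ∂ν := by
    filter_upwards [hX, hDi.prod_left_ae, hXi.prod_left_ae] with ω h1 h2 h3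
    have h2' : IntervalIntegrable (fun s => D s ω) volume 0 T :=
      (intervalIntegrable_iff_integrableOn_Ioc_of_le hT).2 h2
    have h4 := mul_eq_integral_add (α := X₀) (β := 0) h2' (hGi ω 0 T)
    simp only [mul_zero, zero_add] at h4
    rw [← h1 T ⟨hT, le_rfl⟩] at h4
    change X T ω * Γ T ω = _ at h4
    rw [intervalIntegral.integral_of_le hT] at h4
    have h5 : ∫ s, (D s ω * Γ s ω + X s ω * G s ω) ∂ν = X T ω * Γ T ω := by
      rw [h4]
      refine setIntegral_congr_fun measurableSet_Ioc fun s hs => ?_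
      simp only [h1 s ⟨hs.1.le, hs.2⟩]
      rfl
    have h6 : X T ω * (f (ρ T ω) - Γ T ω) = X₀ * (f (ρ T ω) - Γ T ω)
        + ∫ s, D s ω * (f (ρ T ω) - Γ T ω) ∂ν := by
      rw [h1 T ⟨hT, le_rfl⟩, integral_mul_const, intervalIntegral.integral_of_le hT, add_mul]
    have hi1 : Integrable (fun s => D s ω * (f (ρ T ω) - Γ T ω)) ν := h2.mul_const _
    have hi2 : Integrable (fun s => D s ω * Γ s ω) ν :=
      Integrable.mul_bdd (c := c' * T) h2 (hΓc ω).aestronglyMeasurable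
        ((ae_restrict_iff' measurableSet_Ioc).2 (.of_forall fun s hs => hΓb s ⟨hs.1.le, hs.2⟩ ω))
    have hi3 : Integrable (fun s => X s ω * G s ω) ν :=
      Integrable.mul_bdd (c := c') h3 (hGm.comp measurable_prodMk_right).aestronglyMeasurable
        (.of_forall fun s => hc' _)
    have h7 : ∫ s, (D s ω * (f (ρ T ω) - (Γ T ω - Γ s ω)) + X s ω * G s ω) ∂ν =
        ∫ s, D s ω * (f (ρ T ω) - Γ T ω) ∂ν + ∫ s, (D s ω * Γ s ω + X s ω * G s ω) ∂ν := by
      have hi4 : Integrable (fun s => D s ω * Γ s ω + X s ω * G s ω) ν := hi2.add hi3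
      rw [← integral_add hi1 hi4]
      refine integral_congr_ae (.of_forall fun s => ?_)
      ring
    rw [h7, h5, ← add_assoc, ← h6]
    ring
  have hIc : ∀ᵐ z : ℝ × Ω ∂ν.prod μ, z.1 ∈ Set.Ioc 0 (T : ℝ) :=
    Measure.quasiMeasurePreserving_fst.ae (ae_restrict_mem measurableSet_Ioc)
  have hI1 : Integrable (fun z : ℝ × Ω => D z.1 z.2 * (f (ρ T z.2) - (Γ T z.2 - Γ z.1 z.2)))
      (ν.prod μ) := by
    refine hDi.mul_bdd (c := c + (c' * T + c' * T)) ?_ ?_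
    · exact ((hfT.comp measurable_snd).sub ((hΓT.comp measurable_snd).sub hΓm)).aestronglyMeasurable
    · filter_upwards [hIc] with z hz
      exact (norm_sub_le _ _).trans (add_le_add (hc _) ((norm_sub_le _ _).trans
        (add_le_add (hΓb T ⟨hT, le_rfl⟩ _) (hΓb _ ⟨hz.1.le, hz.2⟩ _))))
  have hI2 : Integrable (fun z : ℝ × Ω => X z.1 z.2 * G z.1 z.2) (ν.prod μ) :=
    hXi.mul_bdd (c := c') hGm.aestronglyMeasurable (.of_forall fun z => hc' _)
  have hI3 : Integrable (fun z : ℝ × Ω => D z.1 z.2 * f (ρ z.1.toNNReal z.2)) (ν.prod μ) :=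
    hDi.mul_bdd (c := c) hfm.aestronglyMeasurable (.of_forall fun z => hc _)
  have hI4 : Integrable (fun ω => X₀ * (f (ρ T ω) - Γ T ω)) μ :=
    (Integrable.of_bound (hfT.sub hΓT).aestronglyMeasurable _ (.of_forall hMb)).const_mul _
  have hinit : ∫ ω, X₀ * (f (ρ T ω) - Γ T ω) ∂μ = X₀ * f ρ₀ := by
    have h1 := hρ.integral_mul_sub_integral (zero_le (a := T)) (Y := fun _ => X₀)
      stronglyMeasurable_const (integrable_const _) hf
    rw [NNReal.coe_zero] at h1
    rw [h1, integral_congr_ae (hρ.initial.mono fun ω hω => by rw [hω])]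
    simp
  -- For each s, D s is known at time s, so the martingale property on [s, T] replaces f(ρ_T) - (Γ_T
  -- - Γ_s) by f(ρ_s).
  have hmart : ∫ z : ℝ × Ω, D z.1 z.2 * (f (ρ T z.2) - (Γ T z.2 - Γ z.1 z.2)) ∂ν.prod μ
      = ∫ z : ℝ × Ω, D z.1 z.2 * f (ρ z.1.toNNReal z.2) ∂ν.prod μ := by
    rw [integral_prod _ hI1, integral_prod _ hI3]
    refine integral_congr_ae ?_
    filter_upwards [hDi.prod_right_ae, ae_restrict_mem measurableSet_Ioc] with s h1 hs
    have h2 := hρ.integral_mul_sub_integral (s := s.toNNReal) (T := T)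
      (Real.toNNReal_le_iff_le_coe.2 hs.2) (hDm s) h1 hf
    rw [← h2, Real.coe_toNNReal _ hs.1.le]
    refine integral_congr_ae (.of_forall fun ω => ?_)
    simp only [hΓ]
    rw [intervalIntegral.integral_interval_sub_left (hGi ω _ _) (hGi ω _ _)]
  have hI5 : Integrable (fun z : ℝ × Ω => D z.1 z.2 * (f (ρ T z.2) - (Γ T z.2 - Γ z.1 z.2))
      + X z.1 z.2 * G z.1 z.2) (ν.prod μ) := hI1.add hI2
  rw [integral_congr_ae hpath, integral_add hI4 hI5.integral_prod_right, hinit,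
    integral_add hI3 hI2, ← hmart, ← integral_add hI1 hI2, integral_prod_symm _ hI5]

end IsParameterEvolution

end LPVSystem

/-! ### Continuous families of quadratic forms over a compact space. -/

section Homogeneous

variable {κ E : Type*} [NormedAddCommGroup E] [NormedSpace ℝ E]

theorem eq_norm_sq_mul_of_homogeneous {g : κ → E → ℝ}
    (hh : ∀ k (c : ℝ) x, g k (c • x) = c ^ 2 * g k x) (k : κ) {x : E} (hx : x ≠ 0) :
    g k x = ‖x‖ ^ 2 * g k (‖x‖⁻¹ • x) := by
  rw [← hh, smul_smul, mul_inv_cancel₀ (norm_ne_zero_iff.2 hx), one_smul]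

variable [TopologicalSpace κ]

theorem continuous_toEuclideanLin {k l : ℕ} {M : κ → Matrix (Fin k) (Fin l) ℝ}
    (hM : Continuous M) :
    Continuous fun z : κ × EuclideanSpace ℝ (Fin l) => (M z.1).toEuclideanLin z.2 := by
  simp only [Matrix.toLpLin_apply]
  exact (PiLp.continuous_toLp 2 _).comp ((hM.comp continuous_fst).matrix_mulVec
    ((PiLp.continuous_ofLp 2 _).comp continuous_snd))

variable [CompactSpace κ] [ProperSpace E]

/-- A continuous family of quadratic forms over a compact space is uniformly bounded. -/
theorem exists_le_mul_norm_sq {g : κ → E → ℝ} (hc : Continuous fun z : κ × E => g z.1 z.2)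
    (hh : ∀ k (c : ℝ) x, g k (c • x) = c ^ 2 * g k x) :
    ∃ C, 0 < C ∧ ∀ k x, g k x ≤ C * ‖x‖ ^ 2 := by
  obtain ⟨C, hC⟩ := (isCompact_univ.prod (isCompact_sphere (0 : E) 1)).exists_bound_of_continuousOn
    hc.continuousOn
  refine ⟨|C| + 1, by positivity, fun k x => ?_⟩
  rcases eq_or_ne x 0 with rfl | hx
  · have := hh k 0 0
    simp_all
  · rw [eq_norm_sq_mul_of_homogeneous hh k hx, mul_comm]
    gcongr
    have h1 := hC (k, ‖x‖⁻¹ • x) ⟨trivial, by simp [norm_smul, norm_ne_zero_iff.2 hx]⟩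
    exact (le_abs_self _).trans (h1.trans ((le_abs_self C).trans (by linarith)))

/-- A continuous family of positive definite quadratic forms over a compact space is uniformly
positive definite. -/
theorem exists_mul_norm_sq_le {g : κ → E → ℝ} (hc : Continuous fun z : κ × E => g z.1 z.2)
    (hh : ∀ k (c : ℝ) x, g k (c • x) = c ^ 2 * g k x) (hp : ∀ k x, x ≠ 0 → 0 < g k x) :
    ∃ ε, 0 < ε ∧ ∀ k x, ε * ‖x‖ ^ 2 ≤ g k x := by
  have hs : ∀ (k : κ) {x : E}, x ≠ 0 → (k, ‖x‖⁻¹ • x) ∈ (Set.univ ×ˢ Metric.sphere 0 1 : Set (κ × E)) :=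
    fun k x hx => ⟨trivial, by simp [norm_smul, norm_ne_zero_iff.2 hx]⟩
  have h0 : ∀ k, g k 0 = 0 := fun k => by simpa using hh k 0 0
  -- There is no minimiser if κ is empty or E is trivial; any positive constant works then.
  rcases (Set.univ ×ˢ Metric.sphere 0 1 : Set (κ × E)).eq_empty_or_nonempty with he | hne
  · refine ⟨1, one_pos, fun k x => ?_⟩
    by_cases hx : x = 0
    · simp [hx, h0]
    · exact absurd (hs k hx) (he ▸ Set.notMem_empty _)
  · obtain ⟨z, hz, hmin⟩ := (isCompact_univ.prod (isCompact_sphere (0 : E) 1)).exists_isMinOn hne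
      hc.continuousOn
    have hz0 : z.2 ≠ 0 := by
      rintro h
      simpa [h] using hz.2
    refine ⟨g z.1 z.2, hp _ _ hz0, fun k x => ?_⟩
    by_cases hx : x = 0
    · simp [hx, h0]
    · rw [eq_norm_sq_mul_of_homogeneous hh k hx, mul_comm]
      gcongr
      exact hmin (hs k hx)

/-- A continuous family of matrices over a compact space is uniformly bounded. -/
theorem exists_norm_toEuclideanLin_le {k l : ℕ} {M : κ → Matrix (Fin k) (Fin l) ℝ}
    (hM : Continuous M) : ∃ C, 0 < C ∧ ∀ a x, ‖(M a).toEuclideanLin x‖ ≤ C * ‖x‖ := by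
  obtain ⟨C, hC0, hC⟩ := exists_le_mul_norm_sq
    (g := fun a (x : EuclideanSpace ℝ (Fin l)) => ‖(M a).toEuclideanLin x‖ ^ 2)
    ((continuous_toEuclideanLin hM).norm.pow 2)
    (fun a c x => by rw [map_smul, norm_smul, mul_pow, Real.norm_eq_abs, sq_abs])
  refine ⟨√C, Real.sqrt_pos.2 hC0, fun a x => ?_⟩
  refine abs_le_of_sq_le_sq' ?_ (by positivity) |>.2
  rw [mul_pow, Real.sq_sqrt hC0.le]
  exact hC a x

end Homogeneous

theorem Continuous.matrix_inv_of_det_ne_zero {κ ι : Type*} [TopologicalSpace κ] [Fintype ι]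
    [DecidableEq ι] {M : κ → Matrix ι ι ℝ} (hM : Continuous M) (h : ∀ a, (M a).det ≠ 0) :
    Continuous fun a => (M a)⁻¹ := by
  simp only [Matrix.inv_def, Ring.inverse_eq_inv']
  exact (hM.matrix_det.inv₀ h).smul hM.matrix_adjugate

/-! ### The Lyapunov function and its drift. -/

namespace LPVSystem

variable {N n m p q : ℕ} {S : LPVSystem N n m p q}

/-- The generator of `(ρ, x)` applied to the Lyapunov function `xᵀ (Q ρ)⁻¹ x`, where `d` is the time
derivative of `x`. -/
noncomputable def lyapunovDrift (S : LPVSystem N n m p q) (Q : S.param → Matrix (Fin n) (Fin n) ℝ)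
    (ρ : S.param) (x d : EuclideanSpace ℝ (Fin n)) : ℝ :=
  ∑ i, ∑ j, ((d i * x j + x i * d j) * (Q ρ)⁻¹ i j +
    x i * x j * S.generator (fun θ => (Q θ)⁻¹ i j) ρ)

/-- The Lyapunov function `xᵀ (Q ρ)⁻¹ x`. -/
noncomputable def lyapunov (Q : S.param → Matrix (Fin n) (Fin n) ℝ) (ρ : S.param)
    (x : EuclideanSpace ℝ (Fin n)) : ℝ :=
  ∑ i, ∑ j, x i * x j * (Q ρ)⁻¹ i j

section

variable {Q : S.param → Matrix (Fin n) (Fin n) ℝ}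

theorem lyapunov_eq (ρ : S.param) (x : EuclideanSpace ℝ (Fin n)) :
    lyapunov Q ρ x = x.ofLp ⬝ᵥ (Q ρ)⁻¹ *ᵥ x.ofLp := by
  simp only [lyapunov, dotProduct, Matrix.mulVec, Finset.mul_sum]
  exact Finset.sum_congr rfl fun i _ => Finset.sum_congr rfl fun j _ => by ring

theorem continuous_inv (hQ : Continuous Q) (hpos : ∀ ρ, (Q ρ).PosDef) :
    Continuous fun ρ => (Q ρ)⁻¹ :=
  hQ.matrix_inv_of_det_ne_zero fun ρ => (hpos ρ).det_pos.ne'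

theorem continuous_inv_apply (hQ : Continuous Q) (hpos : ∀ ρ, (Q ρ).PosDef) (i j : Fin n) :
    Continuous fun ρ => (Q ρ)⁻¹ i j :=
  (continuous_inv hQ hpos).matrix_elem i j

/-- The entrywise form suits Dynkin's formula, which treats one entry of the inverse at a time; the
form here is the one that the matrix inequality controls. Symmetry of the inverse merges the two
terms in d, and the generator is linear. -/
theorem lyapunovDrift_eq (hQ : Continuous Q) (hpos : ∀ ρ, (Q ρ).PosDef) (ρ : S.param)
    (x d : EuclideanSpace ℝ (Fin n)) :
    S.lyapunovDrift Q ρ x d = 2 * ((Q ρ)⁻¹ *ᵥ x.ofLp ⬝ᵥ d.ofLp)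
      + (∫ θ, S.rate ρ θ * lyapunov Q θ x ∂S.lebesgue) - S.intensity ρ * lyapunov Q ρ x := by
  have hsymm : ∀ i j, (Q ρ)⁻¹ i j = (Q ρ)⁻¹ j i := fun i j => by
    simpa using ((hpos ρ).inv.isHermitian.apply i j).symm
  have h1 : ∑ i, ∑ j, (d i * x j + x i * d j) * (Q ρ)⁻¹ i j
      = 2 * ((Q ρ)⁻¹ *ᵥ x.ofLp ⬝ᵥ d.ofLp) := by
    have h2 : ∑ i, ∑ j, x i * d j * (Q ρ)⁻¹ i j = ∑ i, ∑ j, d i * x j * (Q ρ)⁻¹ i j := by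
      rw [Finset.sum_comm]
      exact Finset.sum_congr rfl fun i _ => Finset.sum_congr rfl fun j _ => by rw [hsymm]; ring
    simp only [add_mul, Finset.sum_add_distrib]
    rw [h2, ← two_mul]
    simp only [dotProduct, Matrix.mulVec, Finset.sum_mul]
    congr 1
    exact Finset.sum_congr rfl fun i _ => Finset.sum_congr rfl fun j _ => by ring
  have hgen : ∀ i j, S.generator (fun θ => (Q θ)⁻¹ i j) ρ
      = ∫ θ, S.rate ρ θ * (Q θ)⁻¹ i j ∂S.lebesgue - S.intensity ρ * (Q ρ)⁻¹ i j := by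
    intro i j
    simp only [generator, mul_sub]
    have h3 : Integrable (fun θ => S.rate ρ θ * (Q θ)⁻¹ i j) S.lebesgue :=
      integrable_of_continuous ((continuous_rate_right ρ).mul (continuous_inv_apply hQ hpos i j))
    have h4 : Integrable (fun θ => S.rate ρ θ * (Q ρ)⁻¹ i j) S.lebesgue :=
      integrable_of_continuous ((continuous_rate_right ρ).mul continuous_const)
    rw [integral_sub h3 h4, integral_mul_const, intensity]
  have hint : ∫ θ, S.rate ρ θ * lyapunov Q θ x ∂S.lebesgue
      = ∑ i, ∑ j, x i * x j * ∫ θ, S.rate ρ θ * (Q θ)⁻¹ i j ∂S.lebesgue := by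
    simp only [lyapunov, Finset.mul_sum]
    have hc : ∀ i j, Continuous fun θ => S.rate ρ θ * (x i * x j * (Q θ)⁻¹ i j) := fun i j =>
      (continuous_rate_right ρ).mul (continuous_const.mul (continuous_inv_apply hQ hpos i j))
    rw [integral_finsetSum _ fun i _ => integrable_of_continuous
      (continuous_finsetSum _ fun j _ => hc i j)]
    refine Finset.sum_congr rfl fun i _ => ?_
    rw [integral_finsetSum _ fun j _ => integrable_of_continuous (hc i j)]
    refine Finset.sum_congr rfl fun j _ => ?_
    rw [← integral_const_mul]
    congr 1; ext θ; ring
  rw [lyapunovDrift, hint]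
  simp only [Finset.sum_add_distrib]
  rw [h1, add_sub_assoc, lyapunov, Finset.mul_sum, ← Finset.sum_sub_distrib]
  congr 1
  refine Finset.sum_congr rfl fun i _ => ?_
  rw [Finset.mul_sum, ← Finset.sum_sub_distrib]
  exact Finset.sum_congr rfl fun j _ => by rw [hgen]; ring

theorem lyapunov_smul (ρ : S.param) (c : ℝ) (x : EuclideanSpace ℝ (Fin n)) :
    lyapunov Q ρ (c • x) = c ^ 2 * lyapunov Q ρ x := by
  simp only [lyapunov, Finset.mul_sum, PiLp.smul_apply, smul_eq_mul]
  exact Finset.sum_congr rfl fun i _ => Finset.sum_congr rfl fun j _ => by ring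

theorem lyapunov_pos (hpos : ∀ ρ, (Q ρ).PosDef) (ρ : S.param) {x : EuclideanSpace ℝ (Fin n)}
    (hx : x ≠ 0) : 0 < lyapunov Q ρ x := by
  rw [lyapunov_eq]
  have hx' : x.ofLp ≠ 0 := by simpa using hx
  simpa using (hpos ρ).inv.dotProduct_mulVec_pos hx'

theorem continuous_lyapunov (hQ : Continuous Q) (hpos : ∀ ρ, (Q ρ).PosDef) :
    Continuous fun z : S.param × EuclideanSpace ℝ (Fin n) => lyapunov Q z.1 z.2 := by
  refine continuous_finsetSum _ fun i _ => continuous_finsetSum _ fun j _ => ?_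
  have := (continuous_inv_apply hQ hpos i j).comp
    (continuous_fst (X := S.param) (Y := EuclideanSpace ℝ (Fin n)))
  exact Continuous.mul (by fun_prop) this

end

section

variable {γ : ℝ} {Q : S.param → Matrix (Fin n) (Fin n) ℝ} {U : S.param → Matrix (Fin m) (Fin n) ℝ}
  {Z : S.param → S.param → Matrix (Fin n) (Fin n) ℝ}

theorem dotProduct_synthesisMatrix (ρ θ : S.param) (ξ : Fin n → ℝ) (w : Fin p → ℝ) (ζ : Fin q → ℝ)
    (η : Fin n → ℝ) :
    Sum.elim (Sum.elim ξ w) (Sum.elim ζ η) ⬝ᵥ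
      (S.synthesisMatrix γ Q U Z ρ θ *ᵥ Sum.elim (Sum.elim ξ w) (Sum.elim ζ η)) =
    2 * (ξ ⬝ᵥ (S.A ρ * Q ρ + S.B ρ * U ρ) *ᵥ ξ) - S.intensity ρ * (ξ ⬝ᵥ Q ρ *ᵥ ξ)
      + ξ ⬝ᵥ Z ρ θ *ᵥ ξ + 2 * (ξ ⬝ᵥ S.E ρ *ᵥ w) - γ ^ 2 * (w ⬝ᵥ w)
      + 2 * (ζ ⬝ᵥ ((S.C ρ * Q ρ + S.D ρ * U ρ) *ᵥ ξ + S.F ρ *ᵥ w)) - ζ ⬝ᵥ ζ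
      + 2 * (volume.real S.param * √(S.rate ρ θ)) * (ξ ⬝ᵥ Q ρ *ᵥ η)
      - volume.real S.param * (η ⬝ᵥ Q θ *ᵥ η) := by
  have ht : ∀ {k l : ℕ} (M : Matrix (Fin k) (Fin l) ℝ) (a : Fin k → ℝ) (b : Fin l → ℝ),
      b ⬝ᵥ Mᵀ *ᵥ a = a ⬝ᵥ M *ᵥ b := fun M a b => by
    rw [Matrix.mulVec_transpose, dotProduct_comm, Matrix.dotProduct_mulVec]
  simp only [synthesisMatrix, Matrix.fromBlocks_mulVec, sumElim_dotProduct_sumElim,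
    Matrix.add_mulVec, Matrix.sub_mulVec, dotProduct_add, dotProduct_sub, ht, Matrix.smul_mulVec,
    dotProduct_smul, Matrix.neg_mulVec, Matrix.one_mulVec, Matrix.zero_mulVec, smul_eq_mul,
    dotProduct_neg, dotProduct_zero, Function.comp_def, Sum.elim_inl, Sum.elim_inr]
  ring

end

end LPVSystem

theorem EuclideanSpace.dotProduct_self {k : ℕ} (x : EuclideanSpace ℝ (Fin k)) :
    x.ofLp ⬝ᵥ x.ofLp = ‖x‖ ^ 2 := by
  rw [EuclideanSpace.real_norm_sq_eq]
  exact Finset.sum_congr rfl fun i _ => (sq _).symm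

/-! ### From the matrix inequality to the dissipation inequality. -/

namespace LPVSystem

variable {N n m p q : ℕ} {S : LPVSystem N n m p q} {γ : ℝ}
  {Q : S.param → Matrix (Fin n) (Fin n) ℝ} {U : S.param → Matrix (Fin m) (Fin n) ℝ}
  {Z : S.param → S.param → Matrix (Fin n) (Fin n) ℝ}

/-- The right-hand side of the closed-loop state equation. -/
noncomputable def closedDrift (S : LPVSystem N n m p q) (K : S.param → Matrix (Fin m) (Fin n) ℝ)
    (ρ : S.param) (x : EuclideanSpace ℝ (Fin n)) (w : EuclideanSpace ℝ (Fin p)) :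
    EuclideanSpace ℝ (Fin n) :=
  S.drift ρ x ((K ρ).toEuclideanLin x) w

/-- The closed-loop output. -/
noncomputable def closedOutput (S : LPVSystem N n m p q) (K : S.param → Matrix (Fin m) (Fin n) ℝ)
    (ρ : S.param) (x : EuclideanSpace ℝ (Fin n)) (w : EuclideanSpace ℝ (Fin p)) :
    EuclideanSpace ℝ (Fin q) :=
  S.output ρ x ((K ρ).toEuclideanLin x) w

/-- The part of the closed-loop dissipation inequality that depends on the jump target `θ`. -/
noncomputable def dissipation (S : LPVSystem N n m p q) (γ : ℝ)
    (Q : S.param → Matrix (Fin n) (Fin n) ℝ) (U : S.param → Matrix (Fin m) (Fin n) ℝ)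
    (Z : S.param → S.param → Matrix (Fin n) (Fin n) ℝ) (ρ θ : S.param)
    (x : EuclideanSpace ℝ (Fin n)) (w : EuclideanSpace ℝ (Fin p)) : ℝ :=
  2 * ((Q ρ)⁻¹ *ᵥ x.ofLp ⬝ᵥ (S.closedDrift (fun ρ => U ρ * (Q ρ)⁻¹) ρ x w).ofLp)
    - S.intensity ρ * lyapunov Q ρ x
    + (Q ρ)⁻¹ *ᵥ x.ofLp ⬝ᵥ Z ρ θ *ᵥ ((Q ρ)⁻¹ *ᵥ x.ofLp) - γ ^ 2 * ‖w‖ ^ 2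
    + ‖S.closedOutput (fun ρ => U ρ * (Q ρ)⁻¹) ρ x w‖ ^ 2
    + volume.real S.param * (S.rate ρ θ * lyapunov Q θ x)

theorem dotProduct_synthesisMatrix_eq_dissipation (hpos : ∀ ρ, (Q ρ).PosDef) (ρ θ : S.param)
    (x : EuclideanSpace ℝ (Fin n)) (w : EuclideanSpace ℝ (Fin p)) :
    ∃ v : (Fin n ⊕ Fin p) ⊕ (Fin q ⊕ Fin n) → ℝ, (x ≠ 0 → v ≠ 0) ∧
      v ⬝ᵥ (S.synthesisMatrix γ Q U Z ρ θ *ᵥ v) = S.dissipation γ Q U Z ρ θ x w := by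
  have hdet : ∀ ρ, IsUnit (Q ρ).det := fun ρ => (hpos ρ).det_pos.ne'.isUnit
  set ξ := (Q ρ)⁻¹ *ᵥ x.ofLp with hξ
  have hQξ : Q ρ *ᵥ ξ = x.ofLp := by
    rw [hξ, Matrix.mulVec_mulVec, Matrix.mul_nonsing_inv _ (hdet ρ), Matrix.one_mulVec]
  have hQη : Q θ *ᵥ ((Q θ)⁻¹ *ᵥ x.ofLp) = x.ofLp := by
    rw [Matrix.mulVec_mulVec, Matrix.mul_nonsing_inv _ (hdet θ), Matrix.one_mulVec]
  set z := S.closedOutput (fun ρ => U ρ * (Q ρ)⁻¹) ρ x w with hz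
  -- The last two blocks maximise the quadratic form for given ξ and w, which is what a Schur
  -- complement does: 2 ζᵀz - ‖ζ‖² becomes ‖z‖², and the η-terms become μ(𝒫) λ(ρ, θ) V(θ, x).
  refine ⟨Sum.elim (Sum.elim ξ w.ofLp) (Sum.elim z.ofLp (√(S.rate ρ θ) • (Q θ)⁻¹ *ᵥ x.ofLp)),
    fun hx h0 => hx ?_, ?_⟩
  · have h1 : ξ = 0 := funext fun i => congrFun h0 (.inl (.inl i))
    have h2 : x.ofLp = 0 := by rw [← hQξ, h1, Matrix.mulVec_zero]
    simpa using h2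
  · have hKx : (((U ρ * (Q ρ)⁻¹).toEuclideanLin x).ofLp) = U ρ *ᵥ ξ := by
      rw [Matrix.ofLp_toLpLin, Matrix.toLin'_apply, hξ, Matrix.mulVec_mulVec]
    have hd : (S.closedDrift (fun ρ => U ρ * (Q ρ)⁻¹) ρ x w).ofLp
        = (S.A ρ * Q ρ + S.B ρ * U ρ) *ᵥ ξ + S.E ρ *ᵥ w.ofLp := by
      simp only [closedDrift, drift, WithLp.ofLp_add, Matrix.ofLp_toLpLin, Matrix.toLin'_apply] at hKx ⊢
      rw [hKx, Matrix.add_mulVec, ← Matrix.mulVec_mulVec, hQξ, ← Matrix.mulVec_mulVec]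
    have hzz : z.ofLp = (S.C ρ * Q ρ + S.D ρ * U ρ) *ᵥ ξ + S.F ρ *ᵥ w.ofLp := by
      simp only [hz, closedOutput, output, WithLp.ofLp_add, Matrix.ofLp_toLpLin,
        Matrix.toLin'_apply] at hKx ⊢
      rw [hKx, Matrix.add_mulVec, ← Matrix.mulVec_mulVec, hQξ, ← Matrix.mulVec_mulVec]
    have hsymm : ∀ a, ξ ⬝ᵥ Q ρ *ᵥ a = x.ofLp ⬝ᵥ a := fun a => by
      have h3 : (Q ρ)ᵀ = Q ρ := by simpa using (hpos ρ).isHermitian.eq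
      rw [Matrix.dotProduct_mulVec, ← Matrix.mulVec_transpose, h3, hQξ]
    rw [dotProduct_synthesisMatrix, ← hzz, dissipation, hd, ← hξ, hsymm, hsymm,
      EuclideanSpace.dotProduct_self, EuclideanSpace.dotProduct_self, lyapunov_eq, lyapunov_eq,
      Matrix.mulVec_smul, hQη]
    simp only [dotProduct_add, dotProduct_smul, smul_dotProduct, smul_eq_mul, ← hξ]
    rw [dotProduct_comm ((Q θ)⁻¹ *ᵥ x.ofLp)]
    have hs : √(S.rate ρ θ) * √(S.rate ρ θ) = S.rate ρ θ := Real.mul_self_sqrt (S.rate_nonneg ρ θ)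
    linear_combination (volume.real S.param * (x.ofLp ⬝ᵥ (Q θ)⁻¹ *ᵥ x.ofLp)) * hs

section

variable (hpos : ∀ ρ, (Q ρ).PosDef) (hLMI : ∀ ρ θ, (-S.synthesisMatrix γ Q U Z ρ θ).PosDef)

include hpos hLMI

theorem dissipation_nonpos (ρ θ : S.param) (x : EuclideanSpace ℝ (Fin n))
    (w : EuclideanSpace ℝ (Fin p)) : S.dissipation γ Q U Z ρ θ x w ≤ 0 := by
  obtain ⟨v, -, hv⟩ := dotProduct_synthesisMatrix_eq_dissipation (γ := γ) (U := U) (Z := Z)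
    hpos ρ θ x w
  have := (hLMI ρ θ).posSemidef.dotProduct_mulVec_nonneg v
  rw [Matrix.neg_mulVec, dotProduct_neg] at this
  simp only [star_trivial] at this
  linarith

theorem dissipation_neg (ρ θ : S.param) {x : EuclideanSpace ℝ (Fin n)} (hx : x ≠ 0)
    (w : EuclideanSpace ℝ (Fin p)) : S.dissipation γ Q U Z ρ θ x w < 0 := by
  obtain ⟨v, hv0, hv⟩ := dotProduct_synthesisMatrix_eq_dissipation (γ := γ) (U := U) (Z := Z)
    hpos ρ θ x w
  have := (hLMI ρ θ).dotProduct_mulVec_pos (hv0 hx)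
  rw [Matrix.neg_mulVec, dotProduct_neg] at this
  simp only [star_trivial] at this
  linarith

-- On a vector supported in the last block only -μ(𝒫) Q(θ) contributes, so definiteness excludes
-- μ(𝒫) = 0. This permits division by μ(𝒫) after integrating over θ; for n = 0 that block is empty
-- and gives no information.
omit hpos in
theorem volume_param_pos [Nonempty (Fin n)] (ρ : S.param) : 0 < volume.real S.param := by
  have h1 := (hLMI ρ ρ).dotProduct_mulVec_pos
    (x := Sum.elim (Sum.elim 0 0) (Sum.elim 0 1)) fun h0 => by
      simpa using congrFun h0 (.inr (.inr (Classical.arbitrary (Fin n))))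
  rw [Matrix.neg_mulVec, dotProduct_neg, star_trivial, dotProduct_synthesisMatrix] at h1
  refine measureReal_nonneg.lt_of_ne fun h0 => ?_
  simp [← h0] at h1

end

theorem lebesgue_real_univ : S.lebesgue.real Set.univ = volume.real S.param := by
  rw [measureReal_def, lebesgue_univ, measureReal_def]

section

variable (hZ_int : ∀ ρ i j, Integrable (fun θ => Z ρ θ i j) S.lebesgue)

include hZ_int

theorem integrable_dotProduct_mulVec (ρ : S.param) (ξ : Fin n → ℝ) :
    Integrable (fun θ => ξ ⬝ᵥ Z ρ θ *ᵥ ξ) S.lebesgue := by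
  simp only [dotProduct, Matrix.mulVec]
  exact integrable_finsetSum _ fun i _ => (integrable_finsetSum _ fun j _ =>
    (hZ_int ρ i j).mul_const _).const_mul _

theorem integral_dotProduct_mulVec (hZ_zero : ∀ ρ i j, ∫ θ, Z ρ θ i j ∂S.lebesgue = 0)
    (ρ : S.param) (ξ : Fin n → ℝ) : ∫ θ, ξ ⬝ᵥ Z ρ θ *ᵥ ξ ∂S.lebesgue = 0 := by
  simp only [dotProduct, Matrix.mulVec]
  rw [integral_finsetSum _ fun i _ => (integrable_finsetSum _ fun j _ =>
    (hZ_int ρ i j).mul_const _).const_mul _]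
  refine Finset.sum_eq_zero fun i _ => ?_
  rw [integral_const_mul, integral_finsetSum _ fun j _ => (hZ_int ρ i j).mul_const _]
  simp [integral_mul_const, hZ_zero]

variable (hQ : Continuous Q) (hpos : ∀ ρ, (Q ρ).PosDef)

include hQ hpos

omit hZ_int in
theorem integrable_rate_mul_lyapunov (ρ : S.param) (x : EuclideanSpace ℝ (Fin n)) :
    Integrable (fun θ => volume.real S.param * (S.rate ρ θ * lyapunov Q θ x)) S.lebesgue :=
  integrable_of_continuous (continuous_const.mul ((continuous_rate_right ρ).mul
    ((continuous_lyapunov hQ hpos).comp (.prodMk_left x))))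

theorem integrable_dissipation (ρ : S.param) (x : EuclideanSpace ℝ (Fin n))
    (w : EuclideanSpace ℝ (Fin p)) :
    Integrable (fun θ => S.dissipation γ Q U Z ρ θ x w) S.lebesgue :=
  ((((integrable_const _).add (integrable_dotProduct_mulVec hZ_int ρ _)).sub
    (integrable_const _)).add (integrable_const _)).add
    (integrable_rate_mul_lyapunov hQ hpos ρ x)

/-- Terms free of θ acquire the factor μ(𝒫), the jump term carries it already through the scaling of
the matrix blocks, and Z integrates to zero. The common factor can therefore be taken out. -/
theorem integral_dissipation (hZ_zero : ∀ ρ i j, ∫ θ, Z ρ θ i j ∂S.lebesgue = 0) (ρ : S.param)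
    (x : EuclideanSpace ℝ (Fin n)) (w : EuclideanSpace ℝ (Fin p)) :
    ∫ θ, S.dissipation γ Q U Z ρ θ x w ∂S.lebesgue = volume.real S.param *
      (S.lyapunovDrift Q ρ x (S.closedDrift (fun ρ => U ρ * (Q ρ)⁻¹) ρ x w) - γ ^ 2 * ‖w‖ ^ 2
        + ‖S.closedOutput (fun ρ => U ρ * (Q ρ)⁻¹) ρ x w‖ ^ 2) := by
  have h1 := integrable_dotProduct_mulVec hZ_int ρ ((Q ρ)⁻¹ *ᵥ x.ofLp)
  have h2 := integrable_rate_mul_lyapunov hQ hpos ρ x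
  simp only [dissipation]
  rw [integral_add _ h2, integral_add _ (integrable_const _), integral_sub _ (integrable_const _),
    integral_add (integrable_const _) h1, integral_dotProduct_mulVec hZ_int hZ_zero,
    integral_const_mul (volume.real S.param) fun θ => S.rate ρ θ * lyapunov Q θ x,
    lyapunovDrift_eq hQ hpos]
  · simp only [integral_const, lebesgue_real_univ, smul_eq_mul]
    ring
  · exact (integrable_const _).add h1
  · exact ((integrable_const _).add h1).sub (integrable_const _)
  · exact (((integrable_const _).add h1).sub (integrable_const _)).add (integrable_const _)

variable (hZ_zero : ∀ ρ i j, ∫ θ, Z ρ θ i j ∂S.lebesgue = 0)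
  (hLMI : ∀ ρ θ, (-S.synthesisMatrix γ Q U Z ρ θ).PosDef)

include hZ_zero hLMI

/-- The dissipation inequality of the closed loop. -/
theorem lyapunovDrift_add_le (ρ : S.param) (x : EuclideanSpace ℝ (Fin n))
    (w : EuclideanSpace ℝ (Fin p)) :
    S.lyapunovDrift Q ρ x (S.closedDrift (fun ρ => U ρ * (Q ρ)⁻¹) ρ x w)
      + ‖S.closedOutput (fun ρ => U ρ * (Q ρ)⁻¹) ρ x w‖ ^ 2 ≤ γ ^ 2 * ‖w‖ ^ 2 := by
  -- For n = 0 the measure of 𝒫 may vanish, but the dissipation no longer depends on the target, so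
  -- a single θ, here ρ itself, already gives the claim.
  rcases isEmpty_or_nonempty (Fin n) with hn | hn
  · have h1 := dissipation_nonpos hpos hLMI ρ ρ x w
    simp [dissipation, lyapunov, dotProduct] at h1
    simp [lyapunovDrift]
    linarith
  · have h1 := integral_dissipation (γ := γ) (U := U) hZ_int hQ hpos hZ_zero ρ x w
    have h2 : ∫ θ, S.dissipation γ Q U Z ρ θ x w ∂S.lebesgue ≤ 0 :=
      integral_nonpos fun θ => dissipation_nonpos hpos hLMI ρ θ x w
    have h3 := volume_param_pos hLMI ρ
    have h4 := nonpos_of_mul_nonpos_right (h1 ▸ h2) h3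
    linarith

/-- Strictness survives the integration over θ because a pointwise negative integrand on a space of
positive measure has negative integral; no margin uniform in θ is needed. -/
theorem lyapunovDrift_neg (ρ : S.param) {x : EuclideanSpace ℝ (Fin n)} (hx : x ≠ 0) :
    S.lyapunovDrift Q ρ x (S.closedDrift (fun ρ => U ρ * (Q ρ)⁻¹) ρ x 0) < 0 := by
  rcases isEmpty_or_nonempty (Fin n) with hn | hn
  · exact absurd (Subsingleton.elim x 0) hx
  · have h1 := integral_dissipation (γ := γ) (U := U) hZ_int hQ hpos hZ_zero ρ x 0
    have h3 := volume_param_pos hLMI ρ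
    have h2 : 0 < ∫ θ, -S.dissipation γ Q U Z ρ θ x 0 ∂S.lebesgue := by
      have h5 : ∀ θ, 0 < -S.dissipation γ Q U Z ρ θ x 0 := fun θ =>
        neg_pos.2 (dissipation_neg hpos hLMI ρ θ hx 0)
      rw [integral_pos_iff_support_of_nonneg (fun θ => (h5 θ).le)
        (integrable_dissipation hZ_int hQ hpos ρ x 0).neg]
      rw [Function.support_eq_univ fun θ => (h5 θ).ne', lebesgue_univ]
      exact ENNReal.toReal_pos_iff.1 h3 |>.1
    rw [integral_neg, h1] at h2
    have h4 := neg_of_mul_neg_right (neg_pos.1 h2) h3.le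
    have h5 := sq_nonneg ‖S.closedOutput (fun ρ => U ρ * (Q ρ)⁻¹) ρ x 0‖
    simp only [norm_zero] at h4
    linarith

end

theorem continuous_closedDrift {K : S.param → Matrix (Fin m) (Fin n) ℝ} (hK : Continuous K) :
    Continuous fun z : S.param × EuclideanSpace ℝ (Fin n) => S.closedDrift K z.1 z.2 0 := by
  simp only [closedDrift, drift, map_zero, add_zero]
  exact (continuous_toEuclideanLin S.continuous_A).add
    ((continuous_toEuclideanLin S.continuous_B).comp
      (continuous_fst.prodMk (continuous_toEuclideanLin hK)))

theorem continuous_feedbackGain (hQ : Continuous Q) (hpos : ∀ ρ, (Q ρ).PosDef) (hU : Continuous U) :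
    Continuous fun ρ => U ρ * (Q ρ)⁻¹ :=
  hU.matrix_mul (continuous_inv hQ hpos)

/-- Compactness is used only after Z has been integrated out. Since Z need not be continuous, the
matrix inequality itself need not have a uniform margin, whereas the drift is continuous in (ρ, x)
and quadratic in x. -/
theorem exists_lyapunovDrift_le (hZ_int : ∀ ρ i j, Integrable (fun θ => Z ρ θ i j) S.lebesgue)
    (hQ : Continuous Q) (hpos : ∀ ρ, (Q ρ).PosDef) (hU : Continuous U)
    (hZ_zero : ∀ ρ i j, ∫ θ, Z ρ θ i j ∂S.lebesgue = 0)
    (hLMI : ∀ ρ θ, (-S.synthesisMatrix γ Q U Z ρ θ).PosDef) :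
    ∃ ε, 0 < ε ∧ ∀ (ρ : S.param) (x : EuclideanSpace ℝ (Fin n)),
      S.lyapunovDrift Q ρ x (S.closedDrift (fun ρ => U ρ * (Q ρ)⁻¹) ρ x 0) ≤ -(ε * ‖x‖ ^ 2) := by
  have hcd := continuous_closedDrift (S := S) (continuous_feedbackGain hQ hpos hU)
  have hcont : Continuous fun z : S.param × EuclideanSpace ℝ (Fin n) =>
      -S.lyapunovDrift Q z.1 z.2 (S.closedDrift (fun ρ => U ρ * (Q ρ)⁻¹) z.1 z.2 0) := by
    refine (continuous_finsetSum _ fun i _ => continuous_finsetSum _ fun j _ => ?_).neg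
    have h1 := (continuous_inv_apply hQ hpos i j).comp
      (continuous_fst (X := S.param) (Y := EuclideanSpace ℝ (Fin n)))
    have h2 := (continuous_generator (continuous_inv_apply hQ hpos i j)).comp
      (continuous_fst (X := S.param) (Y := EuclideanSpace ℝ (Fin n)))
    exact (Continuous.mul (by fun_prop) h1).add (Continuous.mul (by fun_prop) h2)
  have hhom : ∀ (ρ : S.param) (c : ℝ) (x : EuclideanSpace ℝ (Fin n)),
      -S.lyapunovDrift Q ρ (c • x) (S.closedDrift (fun ρ => U ρ * (Q ρ)⁻¹) ρ (c • x) 0)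
        = c ^ 2 * -S.lyapunovDrift Q ρ x (S.closedDrift (fun ρ => U ρ * (Q ρ)⁻¹) ρ x 0) := by
    intro ρ c x
    have h1 : S.closedDrift (fun ρ => U ρ * (Q ρ)⁻¹) ρ (c • x) 0
        = c • S.closedDrift (fun ρ => U ρ * (Q ρ)⁻¹) ρ x 0 := by
      simp [closedDrift, drift]
    rw [h1]
    simp only [lyapunovDrift, Finset.mul_sum, PiLp.smul_apply, smul_eq_mul, mul_neg]
    congr 1
    exact Finset.sum_congr rfl fun i _ => Finset.sum_congr rfl fun j _ => by ring
  obtain ⟨ε, hε, h⟩ := exists_mul_norm_sq_le hcont hhom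
    fun ρ x hx => neg_pos.2 (lyapunovDrift_neg hZ_int hQ hpos hZ_zero hLMI ρ hx)
  exact ⟨ε, hε, fun ρ x => le_neg.1 (h ρ x)⟩

end LPVSystem

/-! ### Moments and Dynkin's formula along the closed loop. -/

/-- Progressive measurability covers bounded time intervals only. Freezing time at k gives
measurable maps that agree with w as soon as k exceeds the time. -/
theorem MeasureTheory.IsStronglyProgressive.stronglyMeasurable_uncurry {Ω E : Type*}
    {mΩ : MeasurableSpace Ω} {ℱ : Filtration ℝ≥0 mΩ} [TopologicalSpace E]
    [TopologicalSpace.PseudoMetrizableSpace E] {w : ℝ≥0 → Ω → E} (hw : IsStronglyProgressive ℱ w) :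
    StronglyMeasurable fun z : ℝ × Ω => w z.1.toNNReal z.2 := by
  refine stronglyMeasurable_of_tendsto atTop
    (f := fun (k : ℕ) (z : ℝ × Ω) => w (min z.1.toNNReal k) z.2) (fun k => ?_) ?_
  · have h1 : Measurable fun z : ℝ × Ω =>
        (⟨min z.1.toNNReal k, Set.mem_Iic.2 (min_le_right _ _)⟩ : Set.Iic (k : ℝ≥0)) :=
      ((measurable_real_toNNReal.comp measurable_fst).min measurable_const).subtype_mk
    have h2 : Measurable[_, ℱ k] fun z : ℝ × Ω => z.2 := measurable_snd.mono le_rfl (ℱ.le _)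
    exact (hw k).comp_measurable (h1.prodMk h2)
  · refine tendsto_pi_nhds.2 fun z => tendsto_const_nhds.congr' ?_
    obtain ⟨k₀, hk₀⟩ := exists_nat_ge z.1.toNNReal
    filter_upwards [eventually_ge_atTop k₀] with k hk
    rw [min_eq_left (hk₀.trans (by exact_mod_cast hk))]

namespace LPVSystem

variable {N n m p q : ℕ} {S : LPVSystem N n m p q} {Ω : Type u} {mΩ : MeasurableSpace Ω}
  {μ : Measure Ω} {ℱ : Filtration ℝ≥0 mΩ} {ρ₀ : S.param} {ρ : ℝ≥0 → Ω → S.param}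
  {x₀ : EuclideanSpace ℝ (Fin n)} {w : ℝ≥0 → Ω → EuclideanSpace ℝ (Fin p)}
  {x : ℝ≥0 → Ω → EuclideanSpace ℝ (Fin n)} {K : S.param → Matrix (Fin m) (Fin n) ℝ}

theorem continuous_closedDrift_uncurry (hK : Continuous K) :
    Continuous fun y : S.param × EuclideanSpace ℝ (Fin n) × EuclideanSpace ℝ (Fin p) =>
      S.closedDrift K y.1 y.2.1 y.2.2 := by
  have h1 : Continuous fun y : S.param × EuclideanSpace ℝ (Fin n) × EuclideanSpace ℝ (Fin p) =>
    (y.1, y.2.1) := continuous_fst.prodMk (continuous_fst.comp continuous_snd)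
  have h2 : Continuous fun y : S.param × EuclideanSpace ℝ (Fin n) × EuclideanSpace ℝ (Fin p) =>
    (y.1, y.2.2) := continuous_fst.prodMk (continuous_snd.comp continuous_snd)
  have h3 := (continuous_toEuclideanLin hK).comp h1
  have h4 := (continuous_toEuclideanLin S.continuous_A).comp h1
  have h5 := (continuous_toEuclideanLin S.continuous_B).comp (continuous_fst.prodMk h3)
  have h6 := (continuous_toEuclideanLin S.continuous_E).comp h2
  exact (h4.add h5).add h6

theorem continuous_closedOutput_uncurry (hK : Continuous K) :
    Continuous fun y : S.param × EuclideanSpace ℝ (Fin n) × EuclideanSpace ℝ (Fin p) =>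
      S.closedOutput K y.1 y.2.1 y.2.2 := by
  have h1 : Continuous fun y : S.param × EuclideanSpace ℝ (Fin n) × EuclideanSpace ℝ (Fin p) =>
    (y.1, y.2.1) := continuous_fst.prodMk (continuous_fst.comp continuous_snd)
  have h2 : Continuous fun y : S.param × EuclideanSpace ℝ (Fin n) × EuclideanSpace ℝ (Fin p) =>
    (y.1, y.2.2) := continuous_fst.prodMk (continuous_snd.comp continuous_snd)
  have h3 := (continuous_toEuclideanLin hK).comp h1
  have h4 := (continuous_toEuclideanLin S.continuous_C).comp h1
  have h5 := (continuous_toEuclideanLin S.continuous_D).comp (continuous_fst.prodMk h3)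
  have h6 := (continuous_toEuclideanLin S.continuous_F).comp h2
  exact (h4.add h5).add h6

theorem exists_norm_closedDrift_le (hK : Continuous K) :
    ∃ c, 0 < c ∧ ∀ (ρ : S.param) x w, ‖S.closedDrift K ρ x w‖ ≤ c * ‖x‖ + c * ‖w‖ := by
  obtain ⟨a, ha0, ha⟩ := exists_norm_toEuclideanLin_le S.continuous_A
  obtain ⟨b, hb0, hb⟩ := exists_norm_toEuclideanLin_le (S.continuous_B.matrix_mul hK)
  obtain ⟨e, he0, he⟩ := exists_norm_toEuclideanLin_le S.continuous_E
  refine ⟨a + b + e, by positivity, fun ρ x w => ?_⟩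
  have h1 : (S.B ρ).toEuclideanLin ((K ρ).toEuclideanLin x) = (S.B ρ * K ρ).toEuclideanLin x := by
    simp [Matrix.toLpLin_apply, Matrix.mulVec_mulVec]
  rw [closedDrift, drift, h1]
  refine (norm_add₃_le).trans ((add_le_add_three (ha ρ x) (hb ρ x) (he ρ w)).trans ?_)
  nlinarith [norm_nonneg x, norm_nonneg w]

/-- The time derivative of the closed-loop state. -/
noncomputable def stateDeriv (S : LPVSystem N n m p q) (K : S.param → Matrix (Fin m) (Fin n) ℝ)
    (ρ : ℝ≥0 → Ω → S.param) (x : ℝ≥0 → Ω → EuclideanSpace ℝ (Fin n))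
    (w : ℝ≥0 → Ω → EuclideanSpace ℝ (Fin p)) (s : ℝ) (ω : Ω) : EuclideanSpace ℝ (Fin n) :=
  S.closedDrift K (ρ s.toNNReal ω) (x s.toNNReal ω) (w s.toNNReal ω)

theorem lyapunov_nonneg {Q : S.param → Matrix (Fin n) (Fin n) ℝ} (hpos : ∀ ρ, (Q ρ).PosDef)
    (ρ : S.param) (x : EuclideanSpace ℝ (Fin n)) : 0 ≤ lyapunov Q ρ x := by
  rcases eq_or_ne x 0 with rfl | h
  · simp [lyapunov]
  · exact (lyapunov_pos hpos _ h).le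

namespace IsState

theorem measurable {v : ℝ≥0 → Ω → EuclideanSpace ℝ (Fin m)} (hx : S.IsState μ ℱ ρ x₀ v w x)
    (t : ℝ≥0) : Measurable (x t) :=
  (hx.adapted _).mono (ℱ.le t) le_rfl

theorem aestronglyMeasurable_uncurry [SFinite μ] {v : ℝ≥0 → Ω → EuclideanSpace ℝ (Fin m)}
    (hx : S.IsState μ ℱ ρ x₀ v w x) (ν : Measure ℝ) :
    AEStronglyMeasurable (fun z : ℝ × Ω => x z.1.toNNReal z.2) (ν.prod μ) :=
  aestronglyMeasurable_uncurry_of_rightContinuous (Y := fun t ω => x t.toNNReal ω)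
    (fun _ => hx.measurable _) (hx.continuous.mono fun _ hω _ =>
      ((hω.comp continuous_real_toNNReal).tendsto _).mono_left nhdsWithin_le_nhds) ν

variable (hx : S.IsState μ ℱ ρ x₀ (feedback S K ρ x) w x)

include hx

/-- The product rule for the components of the state. -/
theorem mul_eq_add_integral (i j : Fin n) : ∀ᵐ ω ∂μ, ∀ t : ℝ, 0 ≤ t →
    IntervalIntegrable (fun s : ℝ =>
      S.stateDeriv K ρ x w s ω i * x s.toNNReal ω j +
      x s.toNNReal ω i * S.stateDeriv K ρ x w s ω j)
      volume 0 t ∧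
    x t.toNNReal ω i * x t.toNNReal ω j = x₀ i * x₀ j + ∫ s in (0 : ℝ)..t,
      (S.stateDeriv K ρ x w s ω i * x s.toNNReal ω j +
      x s.toNNReal ω i * S.stateDeriv K ρ x w s ω j) := by
  filter_upwards [hx.integral_eq, hx.continuous] with ω h1 hc t ht
  have hci : ∀ k, Continuous fun s : ℝ => x s.toNNReal ω k := fun k =>
    (EuclideanSpace.proj (𝕜 := ℝ) k).continuous.comp (hc.comp continuous_real_toNNReal)
  have hint : ∀ k, ∀ s : ℝ, 0 ≤ s → IntervalIntegrable (fun s : ℝ =>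
      S.stateDeriv K ρ x w s ω k) volume 0 s := by
    intro k s hs
    have h2 := (h1 s.toNNReal).1
    rw [Real.coe_toNNReal _ hs] at h2
    exact ⟨(EuclideanSpace.proj (𝕜 := ℝ) k).integrable_comp h2.1,
      (EuclideanSpace.proj (𝕜 := ℝ) k).integrable_comp h2.2⟩
  have hcomp : ∀ k, ∀ s : ℝ, 0 ≤ s → x s.toNNReal ω k = x₀ k + ∫ r in (0 : ℝ)..s,
      S.stateDeriv K ρ x w r ω k := by
    intro k s hs
    obtain ⟨h2, h3⟩ := h1 s.toNNReal
    rw [Real.coe_toNNReal _ hs] at h2 h3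
    have h4 := congrArg (EuclideanSpace.proj (𝕜 := ℝ) k) h3
    rw [map_add, ← ContinuousLinearMap.intervalIntegral_comp_comm _ h2] at h4
    exact h4
  refine ⟨((hint i t ht).mul_continuousOn (hci j).continuousOn).add
    ((hint j t ht).continuousOn_mul (hci i).continuousOn), ?_⟩
  rw [hcomp i t ht, hcomp j t ht, mul_eq_integral_add (hint i t ht) (hint j t ht)]
  congr 1
  refine intervalIntegral.integral_congr fun s hs => ?_
  rw [Set.uIcc_of_le ht] at hs
  simp only [← hcomp i s hs.1, ← hcomp j s hs.1]

/-- A pathwise bound of the state by the energy of the disturbance. -/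
theorem exists_norm_sq_le (hK : Continuous K) (T : ℝ≥0)
    (hw : ∀ᵐ ω ∂μ, IntegrableOn (fun s : ℝ => ‖w s.toNNReal ω‖ ^ 2) (Set.Ioc 0 (T : ℝ))) :
    ∃ c, 0 ≤ c ∧ ∀ᵐ ω ∂μ, ∀ t ≤ T,
      ‖x t ω‖ ^ 2 ≤ c * (‖x₀‖ ^ 2 + ∫ s in Set.Ioc 0 (T : ℝ), ‖w s.toNNReal ω‖ ^ 2) := by
  obtain ⟨c, hc0, hc⟩ := exists_norm_closedDrift_le (S := S) hK
  -- The derivative of ‖x‖² is at most 2c‖x‖² + 2c‖x‖‖w‖ ≤ 3c‖x‖² + c‖w‖², whence the exponent 3c;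
  -- the factor 1 + c absorbs the coefficients of ‖x₀‖² + cW.
  refine ⟨(1 + c) * Real.exp (3 * c * T), by positivity, ?_⟩
  filter_upwards [hw, hx.continuous, ae_all_iff.2 fun i => hx.mul_eq_add_integral i i]
    with ω hwω hcω hpr
  set W : ℝ := ∫ s in Set.Ioc 0 (T : ℝ), ‖w s.toNNReal ω‖ ^ 2 with hW
  have hW0 : 0 ≤ W := integral_nonneg fun s => by positivity
  have hcont : Continuous fun s : ℝ => ‖x s.toNNReal ω‖ ^ 2 :=
    (hcω.comp continuous_real_toNNReal).norm.pow 2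
  set d : ℝ → EuclideanSpace ℝ (Fin n) := fun s =>
    S.stateDeriv K ρ x w s ω with hd
  have hineq : ∀ t ∈ Set.Icc (0 : ℝ) T, ‖x t.toNNReal ω‖ ^ 2 ≤
      (‖x₀‖ ^ 2 + c * W) + 3 * c * ∫ s in (0 : ℝ)..t, ‖x s.toNNReal ω‖ ^ 2 := by
    intro t ht
    have hwt : IntervalIntegrable (fun s : ℝ => ‖w s.toNNReal ω‖ ^ 2) volume 0 t :=
      (intervalIntegrable_iff_integrableOn_Ioc_of_le ht.1).2
        (hwω.mono_set (Set.Ioc_subset_Ioc_right ht.2))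
    have h1 : ‖x t.toNNReal ω‖ ^ 2 = ‖x₀‖ ^ 2 + ∫ s in (0 : ℝ)..t,
        ∑ i, (d s i * x s.toNNReal ω i + x s.toNNReal ω i * d s i) := by
      rw [intervalIntegral.integral_finsetSum fun i _ => (hpr i t ht.1).1,
        EuclideanSpace.real_norm_sq_eq, EuclideanSpace.real_norm_sq_eq, ← Finset.sum_add_distrib]
      refine Finset.sum_congr rfl fun i _ => ?_
      rw [sq, sq, (hpr i t ht.1).2]
    have h2 : ∫ s in (0 : ℝ)..t, ∑ i, (d s i * x s.toNNReal ω i + x s.toNNReal ω i * d s i) ≤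
        ∫ s in (0 : ℝ)..t, (3 * c * ‖x s.toNNReal ω‖ ^ 2 + c * ‖w s.toNNReal ω‖ ^ 2) := by
      have h0 : IntervalIntegrable (fun s => ∑ i, (d s i * x s.toNNReal ω i
          + x s.toNNReal ω i * d s i)) volume 0 t := by
        have := IntervalIntegrable.sum Finset.univ fun i _ => (hpr i t ht.1).1
        rwa [Finset.sum_fn] at this
      refine intervalIntegral.integral_mono_on ht.1 h0 (((hcont.intervalIntegrable _ _).const_mul _).add (hwt.const_mul _))
        fun s _ => ?_
      have h3 : ∑ i, (d s i * x s.toNNReal ω i + x s.toNNReal ω i * d s i)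
          = 2 * inner ℝ (d s) (x s.toNNReal ω) := by
        simp only [PiLp.inner_apply, Finset.mul_sum, RCLike.inner_apply, conj_trivial]
        exact Finset.sum_congr rfl fun i _ => by ring
      have h4 := real_inner_le_norm (d s) (x s.toNNReal ω)
      have h5 : ‖d s‖ * ‖x s.toNNReal ω‖ ≤ (c * ‖x s.toNNReal ω‖ + c * ‖w s.toNNReal ω‖)
          * ‖x s.toNNReal ω‖ := mul_le_mul_of_nonneg_right (hc (ρ s.toNNReal ω) (x s.toNNReal ω) (w s.toNNReal ω))
        (norm_nonneg (x s.toNNReal ω))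
      rw [h3]
      nlinarith [mul_nonneg hc0.le (sq_nonneg (‖x s.toNNReal ω‖ - ‖w s.toNNReal ω‖))]
    rw [intervalIntegral.integral_add ((hcont.intervalIntegrable _ _).const_mul _)
      (hwt.const_mul _), intervalIntegral.integral_const_mul, intervalIntegral.integral_const_mul]
      at h2
    have h6 : ∫ s in (0 : ℝ)..t, ‖w s.toNNReal ω‖ ^ 2 ≤ W := by
      rw [intervalIntegral.integral_of_le ht.1, hW]
      exact setIntegral_mono_set hwω (.of_forall fun s => by positivity)
        (Set.Ioc_subset_Ioc_right ht.2).eventuallyLE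
    rw [h1]
    nlinarith [mul_le_mul_of_nonneg_left h6 hc0.le]
  intro t ht
  have ht' : (t : ℝ) ≤ T := by exact_mod_cast ht
  have h7 := le_mul_exp_of_le_integral (by positivity) hcont hineq t ⟨t.2, ht'⟩
  rw [Real.toNNReal_coe] at h7
  refine h7.trans ?_
  have h8 : Real.exp (3 * c * t) ≤ Real.exp (3 * c * T) :=
    Real.exp_le_exp.2 (mul_le_mul_of_nonneg_left ht' (by positivity))
  calc _ ≤ (‖x₀‖ ^ 2 + c * W) * Real.exp (3 * c * T) :=
        mul_le_mul_of_nonneg_left h8 (by positivity)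
    _ ≤ ((1 + c) * (‖x₀‖ ^ 2 + W)) * Real.exp (3 * c * T) := by
        gcongr
        nlinarith [mul_nonneg hc0.le (sq_nonneg ‖x₀‖)]
    _ = _ := by ring

variable [IsProbabilityMeasure μ] (hK : Continuous K)
  (hwi : ∀ T : ℝ≥0, Integrable (fun z : ℝ × Ω => ‖w z.1.toNNReal z.2‖ ^ 2)
    ((volume.restrict (Set.Ioc 0 (T : ℝ))).prod μ))

include hK hwi

/-- No moment of the state is assumed: finite second moments are inherited from the energy of the
disturbance through the pathwise Grönwall bound. -/
theorem integrable_norm_sq (t : ℝ≥0) : Integrable (fun ω => ‖x t ω‖ ^ 2) μ := by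
  obtain ⟨c, -, hc⟩ := hx.exists_norm_sq_le hK t (hwi t).prod_left_ae
  refine Integrable.mono' (((integrable_const (‖x₀‖ ^ 2)).add (hwi t).integral_prod_right).const_mul c)
    ((hx.measurable t).norm.pow_const 2).aestronglyMeasurable (hc.mono fun ω hω => ?_)
  rw [Real.norm_of_nonneg (by positivity)]
  exact hω t le_rfl

theorem integrable_norm_sq_uncurry (T : ℝ≥0) :
    Integrable (fun z : ℝ × Ω => ‖x z.1.toNNReal z.2‖ ^ 2)
      ((volume.restrict (Set.Ioc 0 (T : ℝ))).prod μ) := by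
  obtain ⟨c, -, hc⟩ := hx.exists_norm_sq_le hK T (hwi T).prod_left_ae
  have h1 : Integrable (fun z : ℝ × Ω =>
      c * (‖x₀‖ ^ 2 + ∫ s in Set.Ioc 0 (T : ℝ), ‖w s.toNNReal z.2‖ ^ 2))
      ((volume.restrict (Set.Ioc 0 (T : ℝ))).prod μ) :=
    (((integrable_const (‖x₀‖ ^ 2)).add (hwi T).integral_prod_right).const_mul c).comp_snd _
  refine h1.mono' ((hx.aestronglyMeasurable_uncurry _).norm.pow 2) ?_
  filter_upwards [Measure.quasiMeasurePreserving_snd.ae hc,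
    Measure.quasiMeasurePreserving_fst.ae (ae_restrict_mem measurableSet_Ioc)] with z hz hz1
  rw [Real.norm_of_nonneg (by positivity)]
  exact hz _ (Real.toNNReal_le_iff_le_coe.2 hz1.2)

variable (hρ : S.IsParameterEvolution μ ℱ ρ₀ ρ) {Q : S.param → Matrix (Fin n) (Fin n) ℝ}
  (hQ : Continuous Q) (hpos : ∀ ρ, (Q ρ).PosDef)

include hρ hQ hpos in
theorem integrable_lyapunov (t : ℝ≥0) :
    Integrable (fun ω => lyapunov Q (ρ t ω) (x t ω)) μ := by
  obtain ⟨C, hC0, hC⟩ := exists_le_mul_norm_sq (continuous_lyapunov hQ hpos) lyapunov_smul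
  refine ((hx.integrable_norm_sq hK hwi t).const_mul C).mono'
    ((continuous_lyapunov hQ hpos).measurable.comp
      ((hρ.measurable t).prodMk (hx.measurable t))).aestronglyMeasurable (.of_forall fun ω => ?_)
  rw [Real.norm_of_nonneg (lyapunov_nonneg hpos _ _)]
  exact hC _ _

include hρ hQ hpos in
theorem integrable_mul_mul_inv (T : ℝ≥0) (i j : Fin n) :
    Integrable (fun ω => x T ω i * x T ω j * (Q (ρ T ω))⁻¹ i j) μ := by
  have hf := continuous_inv_apply hQ hpos i j
  obtain ⟨b, -, hb⟩ := exists_abs_le hf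
  refine Integrable.mul_bdd (c := b) ?_ (hf.measurable.comp (hρ.measurable T)).aestronglyMeasurable
    (.of_forall fun z => hb _)
  have hm : ∀ k, Measurable fun ω => x T ω k := fun k =>
    (EuclideanSpace.proj (𝕜 := ℝ) k).continuous.measurable.comp (hx.measurable T)
  refine (hx.integrable_norm_sq hK hwi T).mono' ((hm i).mul (hm j)).aestronglyMeasurable
    (.of_forall fun ω => ?_)
  rw [norm_mul, sq]
  exact mul_le_mul (PiLp.norm_apply_le _ i) (PiLp.norm_apply_le _ j) (norm_nonneg _) (norm_nonneg _)

theorem integrable_mul_uncurry (T : ℝ≥0) (i j : Fin n) :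
    Integrable (fun z : ℝ × Ω => x z.1.toNNReal z.2 i * x z.1.toNNReal z.2 j)
      ((volume.restrict (Set.Ioc 0 (T : ℝ))).prod μ) := by
  have hm : ∀ k, AEStronglyMeasurable (fun z : ℝ × Ω => x z.1.toNNReal z.2 k)
      ((volume.restrict (Set.Ioc 0 (T : ℝ))).prod μ) := fun k =>
    (EuclideanSpace.proj (𝕜 := ℝ) k).continuous.comp_aestronglyMeasurable
      (hx.aestronglyMeasurable_uncurry _)
  refine (hx.integrable_norm_sq_uncurry hK hwi T).mono' ((hm i).mul (hm j)) (.of_forall fun z => ?_)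
  rw [norm_mul, sq]
  exact mul_le_mul (PiLp.norm_apply_le _ i) (PiLp.norm_apply_le _ j) (norm_nonneg _) (norm_nonneg _)

variable (hw : IsStronglyProgressive ℱ w)

include hρ hw

omit hwi in
theorem aestronglyMeasurable_stateDeriv (ν : Measure ℝ) :
    AEStronglyMeasurable (fun z : ℝ × Ω => S.stateDeriv K ρ x w z.1 z.2) (ν.prod μ) := by
  have h : AEStronglyMeasurable (fun z : ℝ × Ω =>
      (ρ z.1.toNNReal z.2, x z.1.toNNReal z.2, w z.1.toNNReal z.2)) (ν.prod μ) :=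
    hρ.measurable_uncurry.aestronglyMeasurable.prodMk ((hx.aestronglyMeasurable_uncurry _).prodMk
      hw.stronglyMeasurable_uncurry.aestronglyMeasurable)
  have h' := (continuous_closedDrift_uncurry hK).comp_aestronglyMeasurable h
  exact h'

theorem integrable_stateDeriv_mul (T : ℝ≥0) (i j : Fin n) :
    Integrable (fun z : ℝ × Ω => S.stateDeriv K ρ x w z.1 z.2 i * x z.1.toNNReal z.2 j)
      ((volume.restrict (Set.Ioc 0 (T : ℝ))).prod μ) := by
  obtain ⟨c, hc0, hc⟩ := exists_norm_closedDrift_le (S := S) hK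
  refine (((hx.integrable_norm_sq_uncurry hK hwi T).const_mul (2 * c)).add
    ((hwi T).const_mul c)).mono' ?_ (.of_forall fun z => ?_)
  · exact ((EuclideanSpace.proj (𝕜 := ℝ) i).continuous.comp_aestronglyMeasurable
      (hx.aestronglyMeasurable_stateDeriv hK hρ hw _)).mul
      ((EuclideanSpace.proj (𝕜 := ℝ) j).continuous.comp_aestronglyMeasurable
        (hx.aestronglyMeasurable_uncurry _))
  · rw [norm_mul]
    refine (mul_le_mul (PiLp.norm_apply_le _ i) (PiLp.norm_apply_le _ j) (norm_nonneg _)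
      (norm_nonneg _)).trans ?_
    refine (mul_le_mul_of_nonneg_right (hc _ _ _) (norm_nonneg _)).trans ?_
    simp only [Pi.add_apply]
    nlinarith [mul_nonneg hc0.le (sq_nonneg (‖x z.1.toNNReal z.2‖ - ‖w z.1.toNNReal z.2‖)),
      mul_nonneg hc0.le (sq_nonneg ‖x z.1.toNNReal z.2‖),
      mul_nonneg hc0.le (sq_nonneg ‖w z.1.toNNReal z.2‖)]

theorem integrable_stateDeriv_mul_add (T : ℝ≥0) (i j : Fin n) :
    Integrable (fun z : ℝ × Ω => S.stateDeriv K ρ x w z.1 z.2 i * x z.1.toNNReal z.2 j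
      + x z.1.toNNReal z.2 i * S.stateDeriv K ρ x w z.1 z.2 j)
      ((volume.restrict (Set.Ioc 0 (T : ℝ))).prod μ) :=
  (hx.integrable_stateDeriv_mul hK hwi hρ hw T i j).add
    ((hx.integrable_stateDeriv_mul hK hwi hρ hw T j i).congr (.of_forall fun _ => mul_comm _ _))

omit hx hK hwi hρ hw [IsProbabilityMeasure μ] in
theorem stronglyMeasurable_stateDeriv (hx : S.IsState μ ℱ ρ x₀ (feedback S K ρ x) w x)
    (hK : Continuous K) (hρ : S.IsParameterEvolution μ ℱ ρ₀ ρ) (hw : IsStronglyProgressive ℱ w)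
    (s : ℝ) : StronglyMeasurable[ℱ s.toNNReal] (S.stateDeriv K ρ x w s) := by
  have h : StronglyMeasurable[ℱ s.toNNReal] fun ω =>
      (ρ s.toNNReal ω, x s.toNNReal ω, w s.toNNReal ω) :=
    (hρ.adapted _).stronglyMeasurable.prodMk
      ((hx.adapted _).stronglyMeasurable.prodMk (hw.stronglyAdapted _))
  have h' := (continuous_closedDrift_uncurry hK).comp_stronglyMeasurable h
  exact h'

include hQ hpos

theorem integrable_lyapunovDrift_term (T : ℝ≥0) (i j : Fin n) :
    Integrable (fun z : ℝ × Ω =>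
      (S.stateDeriv K ρ x w z.1 z.2 i * x z.1.toNNReal z.2 j
        + x z.1.toNNReal z.2 i * S.stateDeriv K ρ x w z.1 z.2 j) * (Q (ρ z.1.toNNReal z.2))⁻¹ i j
      + x z.1.toNNReal z.2 i * x z.1.toNNReal z.2 j *
        S.generator (fun θ => (Q θ)⁻¹ i j) (ρ z.1.toNNReal z.2))
      ((volume.restrict (Set.Ioc 0 (T : ℝ))).prod μ) := by
  have hf := continuous_inv_apply hQ hpos i j
  obtain ⟨b, -, hb⟩ := exists_abs_le hf
  obtain ⟨b', -, hb'⟩ := exists_abs_le (continuous_generator hf)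
  exact ((hx.integrable_stateDeriv_mul_add hK hwi hρ hw T i j).mul_bdd (c := b)
    (hf.measurable.comp hρ.measurable_uncurry).aestronglyMeasurable (.of_forall fun z => hb _)).add
    ((hx.integrable_mul_uncurry hK hwi T i j).mul_bdd (c := b')
      ((continuous_generator hf).measurable.comp hρ.measurable_uncurry).aestronglyMeasurable
      (.of_forall fun z => hb' _))

theorem integrable_lyapunovDrift (T : ℝ≥0) :
    Integrable (fun z : ℝ × Ω => S.lyapunovDrift Q (ρ z.1.toNNReal z.2) (x z.1.toNNReal z.2)
      (S.stateDeriv K ρ x w z.1 z.2)) ((volume.restrict (Set.Ioc 0 (T : ℝ))).prod μ) :=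
  integrable_finsetSum _ fun i _ => integrable_finsetSum _ fun j _ =>
    hx.integrable_lyapunovDrift_term hK hwi hρ hQ hpos hw T i j

/-- Dynkin's formula for products applies because each summand of V separates into xᵢxⱼ and a
function of the parameter alone. -/
theorem integral_mul_mul_inv_eq (T : ℝ≥0) (i j : Fin n) :
    ∫ ω, x T ω i * x T ω j * (Q (ρ T ω))⁻¹ i j ∂μ = x₀ i * x₀ j * (Q ρ₀)⁻¹ i j +
      ∫ z : ℝ × Ω, ((S.stateDeriv K ρ x w z.1 z.2 i * x z.1.toNNReal z.2 j
        + x z.1.toNNReal z.2 i * S.stateDeriv K ρ x w z.1 z.2 j) * (Q (ρ z.1.toNNReal z.2))⁻¹ i j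
      + x z.1.toNNReal z.2 i * x z.1.toNNReal z.2 j *
        S.generator (fun θ => (Q θ)⁻¹ i j) (ρ z.1.toNNReal z.2))
      ∂(volume.restrict (Set.Ioc 0 (T : ℝ))).prod μ := by
  have hxa : ∀ s : ℝ, ∀ k, StronglyMeasurable[ℱ s.toNNReal] fun ω => x s.toNNReal ω k := fun s k =>
    (EuclideanSpace.proj (𝕜 := ℝ) k).continuous.comp_stronglyMeasurable
      (hx.adapted _).stronglyMeasurable
  have hda : ∀ s : ℝ, ∀ k, StronglyMeasurable[ℱ s.toNNReal] fun ω => S.stateDeriv K ρ x w s ω k :=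
    fun s k => (EuclideanSpace.proj (𝕜 := ℝ) k).continuous.comp_stronglyMeasurable
      (hx.stronglyMeasurable_stateDeriv hK hρ hw s)
  have h1 := hρ.integral_mul_eq_add_integral T
    (X := fun s ω => x s.toNNReal ω i * x s.toNNReal ω j)
    (D := fun s ω => S.stateDeriv K ρ x w s ω i * x s.toNNReal ω j
      + x s.toNNReal ω i * S.stateDeriv K ρ x w s ω j) (X₀ := x₀ i * x₀ j)
    (fun s => ((hda s i).mul (hxa s j)).add ((hxa s i).mul (hda s j)))
    (hx.integrable_stateDeriv_mul_add hK hwi hρ hw T i j) (hx.integrable_mul_uncurry hK hwi T i j)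
    ((hx.mul_eq_add_integral i j).mono fun ω hω t ht => (hω t ht.1).2)
    (continuous_inv_apply hQ hpos i j)
  simpa only [Real.toNNReal_coe] using h1

/-- Dynkin's formula for the Lyapunov function along the closed loop. -/
theorem integral_lyapunov_eq (T : ℝ≥0) :
    ∫ ω, lyapunov Q (ρ T ω) (x T ω) ∂μ = lyapunov Q ρ₀ x₀ +
      ∫ z : ℝ × Ω, S.lyapunovDrift Q (ρ z.1.toNNReal z.2) (x z.1.toNNReal z.2)
        (S.stateDeriv K ρ x w z.1 z.2) ∂(volume.restrict (Set.Ioc 0 (T : ℝ))).prod μ := by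
  have hterm := hx.integrable_lyapunovDrift_term hK hwi hρ hQ hpos hw T
  have hVi := hx.integrable_mul_mul_inv hK hwi hρ hQ hpos T
  simp only [lyapunov, lyapunovDrift]
  rw [integral_finsetSum _ fun i _ => integrable_finsetSum _ fun j _ => hVi i j,
    integral_finsetSum _ fun i _ => integrable_finsetSum _ fun j _ => hterm i j,
    ← Finset.sum_add_distrib]
  refine Finset.sum_congr rfl fun i _ => ?_
  rw [integral_finsetSum _ fun j _ => hVi i j, integral_finsetSum _ fun j _ => hterm i j,
    ← Finset.sum_add_distrib]
  exact Finset.sum_congr rfl fun j _ => hx.integral_mul_mul_inv_eq hK hwi hρ hQ hpos hw T i j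

end IsState

end LPVSystem

/-! ### Stability and the L₂-gain. -/

theorem lintegral_enorm_sq_eq_ofReal {α E : Type*} {mα : MeasurableSpace α} {μ : Measure α}
    [NormedAddCommGroup E] {f : α → E} (hf : Integrable (fun a => ‖f a‖ ^ 2) μ) :
    ∫⁻ a, ‖f a‖ₑ ^ 2 ∂μ = ENNReal.ofReal (∫ a, ‖f a‖ ^ 2 ∂μ) := by
  rw [ofReal_integral_eq_lintegral_ofReal hf (.of_forall fun a => by positivity)]
  exact lintegral_congr fun a => by rw [ENNReal.ofReal_pow (norm_nonneg _), ofReal_norm]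

theorem integrable_norm_sq_of_lintegral_ne_top {α E : Type*} {mα : MeasurableSpace α}
    {μ : Measure α} [NormedAddCommGroup E] {f : α → E} (hf : AEStronglyMeasurable f μ)
    (h : ∫⁻ a, ‖f a‖ₑ ^ 2 ∂μ ≠ ∞) : Integrable (fun a => ‖f a‖ ^ 2) μ := by
  refine ⟨hf.norm.pow 2, ?_⟩
  rw [HasFiniteIntegral]
  simpa [enorm_pow] using lt_top_iff_ne_top.2 h

theorem setLIntegral_Ici_eq_iSup (f : ℝ → ℝ≥0∞) :
    ∫⁻ s in Set.Ici (0 : ℝ), f s = ⨆ k : ℕ, ∫⁻ s in Set.Ioc (0 : ℝ) k, f s := by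
  have h : Set.Ioi (0 : ℝ) = ⋃ k : ℕ, Set.Ioc (0 : ℝ) k := by
    ext s
    simp only [Set.mem_Ioi, Set.mem_iUnion, Set.mem_Ioc]
    exact ⟨fun hs => (exists_nat_ge s).imp fun k hk => ⟨hs, hk⟩, fun ⟨_, hs, _⟩ => hs⟩
  rw [← setLIntegral_congr (Ioi_ae_eq_Ici (μ := volume) (a := (0 : ℝ))), h,
    setLIntegral_iUnion_of_directed]
  exact Monotone.directed_le fun a b hab => Set.Ioc_subset_Ioc_right (by exact_mod_cast hab)

namespace LPVSystem

variable {N n m p q : ℕ} {S : LPVSystem N n m p q} {γ : ℝ}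
  {Q : S.param → Matrix (Fin n) (Fin n) ℝ} {U : S.param → Matrix (Fin m) (Fin n) ℝ}
  {Z : S.param → S.param → Matrix (Fin n) (Fin n) ℝ}

/-- The expectation v of V is nonincreasing, and V ≤ C‖x‖². Hence T v(T) / C ≤ 𝔼 ∫₀ᵀ ‖x‖² ≤ V(0) /
ε, so v(T) = O(1/T), and V ≥ c‖x‖² transfers this rate to the second moment. -/
theorem meanSquareStable_of_synthesis (hQ : Continuous Q) (hpos : ∀ ρ, (Q ρ).PosDef)
    (hU : Continuous U) (hZ_int : ∀ ρ i j, Integrable (fun θ => Z ρ θ i j) S.lebesgue)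
    (hZ_zero : ∀ ρ i j, ∫ θ, Z ρ θ i j ∂S.lebesgue = 0)
    (hLMI : ∀ ρ θ, (-S.synthesisMatrix γ Q U Z ρ θ).PosDef) :
    LPVSystem.MeanSquareStable.{u} S (fun ρ => U ρ * (Q ρ)⁻¹) := by
  intro Ω mΩ μ ℱ ρ x x₀ ρ₀ hμ hρ hx
  have hK := continuous_feedbackGain hQ hpos hU
  obtain ⟨ε, hε, hdecay⟩ := exists_lyapunovDrift_le hZ_int hQ hpos hU hZ_zero hLMI
  obtain ⟨C, hC, hupper⟩ := exists_le_mul_norm_sq (continuous_lyapunov hQ hpos) lyapunov_smul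
  obtain ⟨c, hc, hlower⟩ := exists_mul_norm_sq_le (continuous_lyapunov hQ hpos) lyapunov_smul
    fun ρ x hx => lyapunov_pos hpos ρ hx
  have hw : IsStronglyProgressive ℱ fun (_ : ℝ≥0) (_ : Ω) => (0 : EuclideanSpace ℝ (Fin p)) :=
    isStronglyProgressive_const ℱ 0
  have hwi : ∀ T : ℝ≥0, Integrable (fun _ : ℝ × Ω => ‖(0 : EuclideanSpace ℝ (Fin p))‖ ^ 2)
      ((volume.restrict (Set.Ioc 0 (T : ℝ))).prod μ) := fun T => by simp
  set v : ℝ≥0 → ℝ := fun t => ∫ ω, lyapunov Q (ρ t ω) (x t ω) ∂μ with hv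
  set G : ℝ × Ω → ℝ := fun z => S.lyapunovDrift Q (ρ z.1.toNNReal z.2) (x z.1.toNNReal z.2)
    (S.stateDeriv (fun ρ => U ρ * (Q ρ)⁻¹) ρ x (fun _ _ => 0) z.1 z.2) with hG
  have hGi := hx.integrable_lyapunovDrift hK hwi hρ hQ hpos hw
  have hdyn : ∀ T, v T = lyapunov Q ρ₀ x₀ + _ := hx.integral_lyapunov_eq hK hwi hρ hQ hpos hw
  have hGle : ∀ z, ε * ‖x z.1.toNNReal z.2‖ ^ 2 ≤ -G z := fun z => le_neg.1 (hdecay _ _)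
  have hG0 : ∀ z, 0 ≤ -G z := fun z => (by positivity : 0 ≤ ε * _).trans (hGle z)
  have hanti : Antitone v := by
    intro s t hst
    rw [hdyn s, hdyn t]
    have h1 : ∫ z, -G z ∂(volume.restrict (Set.Ioc 0 (s : ℝ))).prod μ ≤
        ∫ z, -G z ∂(volume.restrict (Set.Ioc 0 (t : ℝ))).prod μ :=
      integral_mono_measure (Measure.prod_mono (Measure.restrict_mono
        (Set.Ioc_subset_Ioc_right (by exact_mod_cast hst)) le_rfl) le_rfl)
        (.of_forall hG0) (hGi t).neg
    rw [integral_neg, integral_neg] at h1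
    linarith
  have hv0 : ∀ t, 0 ≤ v t := fun t => integral_nonneg fun ω => lyapunov_nonneg hpos _ _
  have hbound : ∀ T : ℝ≥0, ε / C * T * v T ≤ lyapunov Q ρ₀ x₀ := by
    intro T
    have hxi := hx.integrable_norm_sq_uncurry hK hwi T
    have h1 : ε * ∫ z : ℝ × Ω, ‖x z.1.toNNReal z.2‖ ^ 2
          ∂(volume.restrict (Set.Ioc 0 (T : ℝ))).prod μ
        ≤ -∫ z, G z ∂(volume.restrict (Set.Ioc 0 (T : ℝ))).prod μ := by
      rw [← integral_const_mul, ← integral_neg]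
      exact integral_mono (hxi.const_mul _) (hGi T).neg hGle
    have h2 : T * (v T / C) ≤ ∫ z : ℝ × Ω, ‖x z.1.toNNReal z.2‖ ^ 2
        ∂(volume.restrict (Set.Ioc 0 (T : ℝ))).prod μ := by
      rw [integral_prod _ hxi]
      have h3 : ∫ _ in Set.Ioc 0 (T : ℝ), v T / C ≤
          ∫ s in Set.Ioc 0 (T : ℝ), ∫ ω, ‖x s.toNNReal ω‖ ^ 2 ∂μ := by
        refine setIntegral_mono_on (by simp) hxi.integral_prod_left measurableSet_Ioc
          fun s hs => ?_
        rw [div_le_iff₀ hC, mul_comm, ← integral_const_mul]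
        exact (hanti (Real.toNNReal_le_iff_le_coe.2 hs.2)).trans
          (integral_mono (hx.integrable_lyapunov hK hwi hρ hQ hpos _)
            ((hx.integrable_norm_sq hK hwi _).const_mul C) fun ω => hupper _ _)
      simpa using h3
    have h4 := hdyn T
    have h5 := mul_le_mul_of_nonneg_left h2 hε.le
    have h6 : ε / C * T * v T = ε * (T * (v T / C)) := by ring
    linarith [hv0 T]
  have hfin : ∀ t : ℝ≥0, 0 < t → ∫⁻ ω, ‖x t ω‖ₑ ^ 2 ∂μ ≤
      ENNReal.ofReal (lyapunov Q ρ₀ x₀ * C / (ε * c) * (t : ℝ)⁻¹) := by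
    intro t ht
    have ht' : (0 : ℝ) < t := by exact_mod_cast ht
    rw [lintegral_enorm_sq_eq_ofReal (hx.integrable_norm_sq hK hwi t)]
    refine ENNReal.ofReal_le_ofReal ?_
    have h1 : c * ∫ ω, ‖x t ω‖ ^ 2 ∂μ ≤ v t := by
      rw [← integral_const_mul]
      exact integral_mono ((hx.integrable_norm_sq hK hwi _).const_mul c)
        (hx.integrable_lyapunov hK hwi hρ hQ hpos _) fun ω => hlower _ _
    have h2 := (mul_le_mul_of_nonneg_left h1 (by positivity : 0 ≤ ε / C * t)).trans (hbound t)
    have h3 : lyapunov Q ρ₀ x₀ * C / (ε * c) * (t : ℝ)⁻¹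
        = lyapunov Q ρ₀ x₀ / (ε / C * t * c) := by field_simp
    rw [h3, le_div_iff₀ (by positivity)]
    linarith
  have hlim : Tendsto (fun t : ℝ≥0 => ENNReal.ofReal (lyapunov Q ρ₀ x₀ * C / (ε * c) * (t : ℝ)⁻¹))
      atTop (𝓝 0) := by
    have h1 := (tendsto_inv_atTop_zero.comp (NNReal.tendsto_coe_atTop.2 tendsto_id)).const_mul
      (lyapunov Q ρ₀ x₀ * C / (ε * c))
    rw [mul_zero] at h1
    simpa using ENNReal.tendsto_ofReal h1
  refine tendsto_of_tendsto_of_tendsto_of_le_of_le' tendsto_const_nhds hlim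
    (.of_forall fun _ => zero_le) ?_
  filter_upwards [eventually_gt_atTop 0] with t ht using hfin t ht

/-- On [0, T], the expected integral of LV equals 𝔼 V(T) ≥ 0 because V starts at 0. The dissipation
inequality then bounds the output energy by γ² times that of w, uniformly in T. -/
theorem l2Gain_le_of_synthesis (hγ : 0 < γ) (hQ : Continuous Q) (hpos : ∀ ρ, (Q ρ).PosDef)
    (hU : Continuous U) (hZ_int : ∀ ρ i j, Integrable (fun θ => Z ρ θ i j) S.lebesgue)
    (hZ_zero : ∀ ρ i j, ∫ θ, Z ρ θ i j ∂S.lebesgue = 0)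
    (hLMI : ∀ ρ θ, (-S.synthesisMatrix γ Q U Z ρ θ).PosDef) :
    LPVSystem.l2Gain.{u} S (fun ρ => U ρ * (Q ρ)⁻¹) ≤ ENNReal.ofReal γ := by
  simp only [l2Gain, iSup_le_iff]
  intro Ω mΩ μ ℱ ρ₀ ρ w x hrun
  have hμ := hrun.isProbabilityMeasure
  have hρ := hrun.parameter
  have hw := hrun.progressive
  have hx := hrun.state
  have hK := continuous_feedbackGain hQ hpos hU
  have hwm := hw.stronglyMeasurable_uncurry
  have hw1 : ∫⁻ s in Set.Ici (0 : ℝ), ∫⁻ ω, ‖w s.toNNReal ω‖ₑ ^ 2 ∂μ = 1 := by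
    have h1 := congrArg (fun a : ℝ≥0∞ => a ^ (2 : ℝ)) hrun.norm_eq_one
    simpa only [l2Norm, ← ENNReal.rpow_mul, one_div, inv_mul_cancel₀ (two_ne_zero' ℝ),
      ENNReal.rpow_one, ENNReal.one_rpow] using h1
  have hwT : ∀ T : ℝ≥0, ∫⁻ z : ℝ × Ω, ‖w z.1.toNNReal z.2‖ₑ ^ 2
      ∂(volume.restrict (Set.Ioc 0 (T : ℝ))).prod μ ≤ 1 := by
    intro T
    rw [lintegral_prod _ (hwm.aestronglyMeasurable.enorm.pow_const 2), ← hw1]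
    exact lintegral_mono_set fun s hs => hs.1.le
  have hwi : ∀ T : ℝ≥0, Integrable (fun z : ℝ × Ω => ‖w z.1.toNNReal z.2‖ ^ 2)
      ((volume.restrict (Set.Ioc 0 (T : ℝ))).prod μ) := fun T =>
    integrable_norm_sq_of_lintegral_ne_top hwm.aestronglyMeasurable
      (ne_top_of_le_ne_top ENNReal.one_ne_top (hwT T))
  set y : ℝ × Ω → EuclideanSpace ℝ (Fin q) := fun z => S.closedOutput (fun ρ => U ρ * (Q ρ)⁻¹)
    (ρ z.1.toNNReal z.2) (x z.1.toNNReal z.2) (w z.1.toNNReal z.2) with hy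
  have hym : ∀ ν : Measure ℝ, AEStronglyMeasurable y (ν.prod μ) := by
    intro ν
    have h : AEStronglyMeasurable (fun z : ℝ × Ω =>
        (ρ z.1.toNNReal z.2, x z.1.toNNReal z.2, w z.1.toNNReal z.2)) (ν.prod μ) :=
      hρ.measurable_uncurry.aestronglyMeasurable.prodMk ((hx.aestronglyMeasurable_uncurry _).prodMk
        hwm.aestronglyMeasurable)
    have h' := (continuous_closedOutput_uncurry hK).comp_aestronglyMeasurable h
    exact h'
  have hdiss : ∀ z : ℝ × Ω, S.lyapunovDrift Q (ρ z.1.toNNReal z.2) (x z.1.toNNReal z.2)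
      (S.stateDeriv (fun ρ => U ρ * (Q ρ)⁻¹) ρ x w z.1 z.2) + ‖y z‖ ^ 2
        ≤ γ ^ 2 * ‖w z.1.toNNReal z.2‖ ^ 2 := fun z =>
    lyapunovDrift_add_le hZ_int hQ hpos hZ_zero hLMI _ _ _
  have hT : ∀ T : ℝ≥0, ∫⁻ z, ‖y z‖ₑ ^ 2 ∂(volume.restrict (Set.Ioc 0 (T : ℝ))).prod μ
      ≤ ENNReal.ofReal (γ ^ 2) := by
    intro T
    have hGi := hx.integrable_lyapunovDrift hK hwi hρ hQ hpos hw T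
    -- The dissipation inequality itself supplies the integrable majorant γ²‖w‖² - LV.
    have hyi : Integrable (fun z => ‖y z‖ ^ 2) ((volume.restrict (Set.Ioc 0 (T : ℝ))).prod μ) := by
      refine (((hwi T).const_mul (γ ^ 2)).sub hGi).mono' ((hym _).norm.pow 2)
        (.of_forall fun z => ?_)
      rw [Real.norm_of_nonneg (by positivity), Pi.sub_apply]
      linarith [hdiss z]
    have h1 := integral_mono (hGi.add hyi) ((hwi T).const_mul (γ ^ 2)) hdiss
    simp only [Pi.add_apply] at h1
    rw [integral_add hGi hyi, integral_const_mul] at h1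
    have h2 := hx.integral_lyapunov_eq hK hwi hρ hQ hpos hw T
    have h3 : lyapunov Q ρ₀ 0 = 0 := by simp [lyapunov]
    have h4 : 0 ≤ ∫ ω, lyapunov Q (ρ T ω) (x T ω) ∂μ :=
      integral_nonneg fun ω => lyapunov_nonneg hpos _ _
    rw [lintegral_enorm_sq_eq_ofReal hyi]
    calc ENNReal.ofReal (∫ z, ‖y z‖ ^ 2 ∂(volume.restrict (Set.Ioc 0 (T : ℝ))).prod μ)
        ≤ ENNReal.ofReal (γ ^ 2 * ∫ z : ℝ × Ω, ‖w z.1.toNNReal z.2‖ ^ 2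
            ∂(volume.restrict (Set.Ioc 0 (T : ℝ))).prod μ) :=
          ENNReal.ofReal_le_ofReal (by linarith)
      _ ≤ ENNReal.ofReal (γ ^ 2) * 1 := by
          rw [ENNReal.ofReal_mul (by positivity), ← lintegral_enorm_sq_eq_ofReal (hwi T)]
          exact mul_le_mul_right (hwT T) _
      _ = _ := mul_one _
  have hfin : ∫⁻ s in Set.Ici (0 : ℝ), ∫⁻ ω, ‖y (s, ω)‖ₑ ^ 2 ∂μ ≤ ENNReal.ofReal (γ ^ 2) := by
    rw [setLIntegral_Ici_eq_iSup]
    refine iSup_le fun k => ?_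
    have h1 := hT k
    rw [lintegral_prod _ ((hym _).enorm.pow_const 2)] at h1
    exact_mod_cast h1
  calc l2Norm μ (fun t ω => S.output (ρ t ω) (x t ω)
        (feedback S (fun ρ => U ρ * (Q ρ)⁻¹) ρ x t ω) (w t ω))
      = (∫⁻ s in Set.Ici (0 : ℝ), ∫⁻ ω, ‖y (s, ω)‖ₑ ^ 2 ∂μ) ^ (1 / 2 : ℝ) := rfl
    _ ≤ (ENNReal.ofReal (γ ^ 2)) ^ (1 / 2 : ℝ) := ENNReal.rpow_le_rpow hfin (by norm_num)
    _ = ENNReal.ofReal γ := by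
        rw [ENNReal.ofReal_rpow_of_nonneg (by positivity) (by norm_num), ← Real.sqrt_eq_rpow,
          Real.sqrt_sq hγ.le]

end LPVSystem

theorem theorem3 {N n m p q : ℕ} (S : LPVSystem N n m p q) (γ : ℝ) (hγ : 0 < γ)
    (Q : S.param → Matrix (Fin n) (Fin n) ℝ) (U : S.param → Matrix (Fin m) (Fin n) ℝ)
    (Z : S.param → S.param → Matrix (Fin n) (Fin n) ℝ)
    (hQ_cont : Continuous Q) (hQ_pos : ∀ ρ, (Q ρ).PosDef) (hU_cont : Continuous U)
    (hZ_symm : ∀ ρ θ, (Z ρ θ).IsSymm)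
    (hZ_int : ∀ ρ i j, Integrable (fun θ => Z ρ θ i j) S.lebesgue)
    (hZ_zero : ∀ ρ i j, ∫ θ, Z ρ θ i j ∂S.lebesgue = 0)
    (hLMI : ∀ ρ θ, (-S.synthesisMatrix γ Q U Z ρ θ).PosDef) :
    LPVSystem.MeanSquareStable.{u} S (fun ρ => U ρ * (Q ρ)⁻¹) ∧
      LPVSystem.l2Gain.{u} S (fun ρ => U ρ * (Q ρ)⁻¹) ≤ ENNReal.ofReal γ :=
  ⟨LPVSystem.meanSquareStable_of_synthesis hQ_cont hQ_pos hU_cont hZ_int hZ_zero hLMI,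
    LPVSystem.l2Gain_le_of_synthesis hγ hQ_cont hQ_pos hU_cont hZ_int hZ_zero hLMI⟩
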